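/- **Setting.** Let $H$ be a real separable infinite-dimensional Hilbert space (for instance $L^2([0,1])$), let $L^2_H$ be the Hilbert space of square integrable $H$-valued random elements on a probability space, and let $\mathcal L$ be the bounded operators on $H$ with operator norm $\|\cdot\|_{\mathcal L}$. For $y,z\in H$ put $(y\otimes z)x=\langle y,x\rangle z$; for centred $Y,Z\in L^2_H$ put $C_{Y,Z}=E[Y\otimes Z]$ and $C_Y=C_{Y,Y}$. White noise is a centred sequence $(\varepsilon_n)_{n\in\mathbb Z}$ in $L^2_H$ with $E\|\varepsilon_n\|^2>0$, $C_{\varepsilon_n}=C_\varepsilon$ for all $n$, and $C_{\varepsilon_n,\varepsilon_m}=0$ for $n\ne m$. Let $(X_n)_{n\in\mathbb Z}$ be a weakly stationary, centred functional linear process $X_n=\sum_{j\ge 0}\psi_j\varepsilon_{n-j}$ ($\psi_j\in\mathcal L$, $\psi_0=I_H$, convergence in $L^2_H$) with white noise $(\varepsilon_n)$, which is invertible: $X_n=\varepsilon_n+\sum_{j\ge1}\pi_jX_{n-j}$ with $\pi_j\in\mathcal L$ and $\sum_{j\ge 1}\|\pi_j\|_{\mathcal L}<\infty$. Put $C_{X;h}=E[X_0\otimes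 X_h]$. Assume that all eigenvalues of $C_\varepsilon$ are positive and that all eigenvalues of $C_X=C_{X;0}$ are positive; let $(\lambda_j,\nu_j)_{j\ge1}$ be the eigenpairs of $C_X$, with $\lambda_1\ge\lambda_2\ge\dots>0$ and $(\nu_j)$ an orthonormal basis of $H$. Put $A_D=\mathrm{span}\{\nu_1,\dots,\nu_D\}$, with orthogonal projection $P_{A_D}$, and $X_{D,n}=P_{A_D}X_n$. Let $(m_n)$ and $(d_n)$ be non-decreasing sequences of integers with $m_n\to\infty$, $m_n<n$ for all large $n$, $m_n/n\to0$, $d_n\ge1$ and $d_n\to\infty$. **Predictor and algorithm.** Let $\widehat X_{d_{n+1},n+1}$ be the orthogonal projection in $L^2_H$ of $X_{n+1}$ onto the smallest closed linear subspace that contains $X_{d_1,1},\dots,X_{d_n,n}$ and is stable under all $l\in\mathcal L$. The innovations algorithm on the increasing subspaces is the recursion $$\theta_{n,n-k}=\Big(P_{A_{d_{n+1}}}C_{X;n-k}P_{A_{d_{k+1}}}-\sum_{j=0}^{k-1}\theta_{n,n-j}V_j\theta_{k,k-j}^*\Big)V_k^{-1},\qquad 0\le k<n,$$ $$V_n=P_{A_{d_{n+1}}}C_XP_{A_{d_{n+1}}}-\sum_{j=0}^{n-1}\theta_{n,n-j}V_j\theta_{n,n-j}^*,\qquad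 n\ge 0,$$ where $V_k^{-1}$ is the inverse on $A_{d_{k+1}}$, extended by $0$ to $A_{d_{k+1}}^\perp$. Its output is $\widetilde X_1=0$, $\widetilde X_{n+1}=\sum_{i=1}^n\theta_{n,i}(X_{d_{n+1-i},n+1-i}-\widetilde X_{n+1-i})$. Let $R_n=\sum_{j>m_n}\|\pi_j\|_{\mathcal L}+\sum_{j>d_{n-m_n}}\lambda_j$. **(i)** As $n\to\infty$, $$E\|X_{n+1}-\widehat X_{d_{n+1},n+1}-\varepsilon_{n+1}\|^2=O(R_n),\qquad E\|X_{n+1}-\widetilde X_{n+1}-\varepsilon_{n+1}\|^2=O(R_n),\qquad R_n\to0 .$$ **(ii)** Assume in addition that $\sum_j\|\psi_j\|_{\mathcal L}<\infty$. For $D\ge1$ let $\mathbf X_{D,n}=(\langle X_n,\nu_1\rangle,\dots,\langle X_n,\nu_D\rangle)^\top$ and $C_{\mathbf X_D;h}=E[\mathbf X_{D,h}\mathbf X_{D,0}^\top]$. For every $n$ and every $-\pi<\omega\le\pi$ the series of the spectral density matrix $f_{\mathbf X_{d_n}}[\omega]=\frac1{2\pi}\sum_{h\in\mathbb Z}e^{-ih\omega}C_{\mathbf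 X_{d_n};h}$ converges absolutely, the matrix is Hermitian and all its eigenvalues are positive; moreover the infimum $\alpha_{d_n}$ of these eigenvalues over all $\omega\in(-\pi,\pi]$ is positive. If $R_n/\alpha_{d_n}\to0$ as $n\to\infty$, then for every fixed $i\ge1$ and every $x\in H$, $$\|(\theta_{n,i}-\psi_i)(x)\|\to0,\qquad n\to\infty .$$ More generally, let $(u_k)$ be a sequence of positive integers with $u_k\to\infty$, and let $i\ge1$. If $R_{u_k-r}/\alpha_{d_{u_k-r}}\to0$ as $k\to\infty$ for each $r=0,\dots,i-1$, then $\|(\theta_{u_k,i}-\psi_i)(x)\|\to0$ as $k\to\infty$ for every $x\in H$. -/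

import Mathlib

open MeasureTheory Filter Topology Asymptotics

namespace FunctionalLinearProcess

noncomputable section

variable {Ω : Type*} [MeasurableSpace Ω] {P : Measure Ω}
variable {H : Type*} [NormedAddCommGroup H] [InnerProductSpace ℝ H]

/-! ### Second order structure of `H`-valued random elements

The space `L²_H` of square integrable random elements is `Lp H 2 P`; for a bounded operator `l` on
`H` and `Z` in `L²_H`, the random element `l Z` is `l.compLp Z`. -/

/-- The cross covariance operator `C_{Y,Z} = E[Y ⊗ Z]` (of centred random elements), where
`(y ⊗ z) x = ⟨y, x⟩ z`, so that `C_{Y,Z} x = E[⟨Y, x⟩ Z]`. -/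
def crossCov (Y Z : Lp H 2 P) : H →L[ℝ] H :=
  ∫ ω, InnerProductSpace.rankOne ℝ (Z ω) (Y ω) ∂P

/-- White noise: centred, of constant covariance operator and positive variance, and with vanishing
cross covariance operators at different times. -/
structure IsWhiteNoise (ε : ℤ → Lp H 2 P) : Prop where
  mean_zero : ∀ n, ∫ ω, ε n ω ∂P = 0
  variance_pos : ∀ n, 0 < ∫ ω, ‖ε n ω‖ ^ 2 ∂P
  cov_eq : ∀ n, crossCov (ε n) (ε n) = crossCov (ε 0) (ε 0)
  uncorrelated : ∀ n m, n ≠ m → crossCov (ε n) (ε m) = 0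

/-- Weak stationarity of a centred process. -/
structure IsWeaklyStationary (X : ℤ → Lp H 2 P) : Prop where
  mean_zero : ∀ n, ∫ ω, X n ω ∂P = 0
  cov_eq : ∀ n h, crossCov (X n) (X (n + h)) = crossCov (X 0) (X h)

/-- The functional linear process `X_n = ∑_{j ≥ 0} ψ_j ε_{n-j}` with `ψ_0 = I`, the series
converging in `L²_H`. -/
structure IsLinearProcess (ψ : ℕ → H →L[ℝ] H) (ε X : ℤ → Lp H 2 P) : Prop where
  coeff_zero : ψ 0 = ContinuousLinearMap.id ℝ H
  hasSum : ∀ n : ℤ, HasSum (fun j : ℕ => (ψ j).compLp (ε (n - j))) (X n)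

/-- The inverse representation `X_n = ε_n + ∑_{j ≥ 1} π_j X_{n-j}` with `∑_{j ≥ 1} ‖π_j‖ < ∞`.
The value `π 0` plays no role. -/
structure IsInverseRepresentation (π : ℕ → H →L[ℝ] H) (ε X : ℤ → Lp H 2 P) : Prop where
  summable_norm : Summable fun j : ℕ => ‖π (j + 1)‖
  hasSum : ∀ n : ℤ,
    HasSum (fun j : ℕ => (π (j + 1)).compLp (X (n - (j + 1 : ℕ)))) (X n - ε n)

/-- The covariance operator `C_{X;h} = E[X_0 ⊗ X_h]` with lag `h`. -/
def lagCov (X : ℤ → Lp H 2 P) (h : ℤ) : H →L[ℝ] H := crossCov (X 0) (X h)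

/-! ### Projections, `ℒ`-closed subspaces and the best linear predictor

The orthonormal basis `ν` is indexed from `0`: the `D`-dimensional space `A_D` is spanned by
`ν 0, …, ν (D - 1)`. -/

/-- The space `A_D` spanned by the first `D` basis vectors. -/
def basisSpan (ν : HilbertBasis ℕ ℝ H) (D : ℕ) : Submodule ℝ H :=
  Submodule.span ℝ (ν '' Set.Iio D)

instance (ν : HilbertBasis ℕ ℝ H) (D : ℕ) : FiniteDimensional ℝ (basisSpan ν D) :=
  FiniteDimensional.span_of_finite ℝ ((Set.finite_Iio D).image ν)

/-- The orthogonal projection `P_{A_D}` of `H` onto `A_D`. -/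
def proj (ν : HilbertBasis ℕ ℝ H) (D : ℕ) : H →L[ℝ] H := (basisSpan ν D).starProjection

/-- The projected random element `X_{d_k,k} = P_{A_{d_k}} X_k`. -/
def projX (ν : HilbertBasis ℕ ℝ H) (d : ℕ → ℕ) (X : ℤ → Lp H 2 P) (k : ℕ) : Lp H 2 P :=
  (proj ν (d k)).compLp (X k)

/-- The `ℒ`-closed subspace of `L²_H` generated by `F`: the smallest closed linear subspace that
contains `F` and is stable under all bounded operators on `H`. -/
def lcs (F : Set (Lp H 2 P)) : Submodule ℝ (Lp H 2 P) :=
  sInf {G | IsClosed (G : Set (Lp H 2 P)) ∧ (∀ (l : H →L[ℝ] H), ∀ Z ∈ G, l.compLp Z ∈ G) ∧ F ⊆ G}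

theorem isClosed_lcs (F : Set (Lp H 2 P)) : IsClosed (lcs F : Set (Lp H 2 P)) := by
  rw [lcs, Submodule.coe_sInf]
  exact isClosed_biInter fun G hG => hG.1

variable [CompleteSpace H]

instance (F : Set (Lp H 2 P)) : CompleteSpace (lcs F) :=
  (isClosed_lcs F).completeSpace_coe

/-- The best linear functional predictor of `X_{n+1}` based on `X_{d_1,1}, …, X_{d_n,n}`, i.e. the
orthogonal projection of `X_{n+1}` onto the `ℒ`-closed subspace which they generate. -/
def bestPredictor (ν : HilbertBasis ℕ ℝ H) (d : ℕ → ℕ) (X : ℤ → Lp H 2 P) (n : ℕ) : Lp H 2 P :=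
  (lcs {Z | ∃ k : ℕ, 1 ≤ k ∧ k ≤ n ∧ Z = projX ν d X k}).starProjection (X (n + 1))

/-! ### The innovations algorithm on increasing subspaces -/

/-- The inverse on `A_D` of an operator `V` (compressed to `A_D`), extended by `0` to the
orthogonal complement of `A_D`. -/
def invOn (ν : HilbertBasis ℕ ℝ H) (D : ℕ) (V : H →L[ℝ] H) : H →L[ℝ] H :=
  (basisSpan ν D).subtypeL ∘L
    ((basisSpan ν D).orthogonalProjectionOnto ∘L V ∘L (basisSpan ν D).subtypeL).inverse ∘L
      (basisSpan ν D).orthogonalProjectionOnto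

/-- The two families of the algorithm in one recursion, for lagged covariance operators `C`:
`innov n k` is `θ_{d_{k+1},n,n-k}` for `k < n`, and `innov n n` is `V_{d_{n+1},n}`. -/
def innov (C : ℤ → H →L[ℝ] H) (ν : HilbertBasis ℕ ℝ H) (d : ℕ → ℕ) :
    ℕ → ℕ → H →L[ℝ] H := fun n k =>
  if _h : k < n then
    (proj ν (d (n + 1)) ∘L C ((n : ℤ) - k) ∘L proj ν (d (k + 1)) -
        ∑ j : Fin k, innov C ν d n j ∘L innov C ν d j j ∘L
          ContinuousLinearMap.adjoint (innov C ν d k j)) ∘L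
      invOn ν (d (k + 1)) (innov C ν d k k)
  else
    proj ν (d (n + 1)) ∘L C 0 ∘L proj ν (d (n + 1)) -
      ∑ j : Fin n, innov C ν d n j ∘L innov C ν d j j ∘L
        ContinuousLinearMap.adjoint (innov C ν d n j)
termination_by n k => (n, min n k)
decreasing_by
  all_goals first
    | (apply Prod.Lex.left; omega)
    | (apply Prod.Lex.right; omega)

/-- The coefficient `θ_{n,i} = θ_{d_{n+1-i},n,i}`, `1 ≤ i ≤ n`, of the algorithm. -/
def theta (C : ℤ → H →L[ℝ] H) (ν : HilbertBasis ℕ ℝ H) (d : ℕ → ℕ) (n i : ℕ) : H →L[ℝ] H :=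
  innov C ν d n (n - i)

/-- The operator `V_{d_{n+1},n}` of the algorithm. -/
def errorCov (C : ℤ → H →L[ℝ] H) (ν : HilbertBasis ℕ ℝ H) (d : ℕ → ℕ) (n : ℕ) : H →L[ℝ] H :=
  innov C ν d n n

/-- The recursion for the coefficients `θ`. -/
theorem theta_rec (C : ℤ → H →L[ℝ] H) (ν : HilbertBasis ℕ ℝ H) (d : ℕ → ℕ) {n k : ℕ}
    (h : k < n) :
    theta C ν d n (n - k) =
      (proj ν (d (n + 1)) ∘L C ((n : ℤ) - k) ∘L proj ν (d (k + 1)) -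
        ∑ j ∈ Finset.range k, theta C ν d n (n - j) ∘L errorCov C ν d j ∘L
          ContinuousLinearMap.adjoint (theta C ν d k (k - j))) ∘L
      invOn ν (d (k + 1)) (errorCov C ν d k) := by
  have h1 : n - (n - k) = k := by omega
  rw [theta, h1, innov, dif_pos h, Finset.sum_range]
  congr 2
  refine Finset.sum_congr rfl fun j _ => ?_
  have h2 : n - (n - (j : ℕ)) = j := by omega
  have h3 : k - (k - (j : ℕ)) = j := by omega
  simp only [theta, errorCov, h2, h3]

/-- The recursion for the operators `V`; in particular `V_{d_1,0} = P_{A_{d_1}} C_X P_{A_{d_1}}`. -/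
theorem errorCov_rec (C : ℤ → H →L[ℝ] H) (ν : HilbertBasis ℕ ℝ H) (d : ℕ → ℕ) (n : ℕ) :
    errorCov C ν d n =
      proj ν (d (n + 1)) ∘L C 0 ∘L proj ν (d (n + 1)) -
        ∑ j ∈ Finset.range n, theta C ν d n (n - j) ∘L errorCov C ν d j ∘L
          ContinuousLinearMap.adjoint (theta C ν d n (n - j)) := by
  rw [errorCov, innov, dif_neg (lt_irrefl n), Finset.sum_range]
  congr 1
  refine Finset.sum_congr rfl fun j _ => ?_
  have h2 : n - (n - (j : ℕ)) = j := by omega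
  simp only [theta, errorCov, h2]

/-- The output of the algorithm: with `X̂_{k}` the value at `k - 1`, one has `X̂_1 = 0` and
`X̂_{n+1} = ∑_{i=1}^n θ_{n,i} (X_{d_{n+1-i},n+1-i} - X̂_{n+1-i})`; here `j = i - 1`. -/
def algPredictor (ν : HilbertBasis ℕ ℝ H) (d : ℕ → ℕ) (X : ℤ → Lp H 2 P) :
    ℕ → Lp H 2 P := fun n =>
  ∑ j : Fin n, (theta (lagCov X) ν d n (j + 1)).compLp
    (projX ν d X (n - j) - algPredictor ν d X (n - (j + 1)))
termination_by n => n
decreasing_by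
  have := j.2
  omega

/-- `E‖X_{n+1} - X̂ - ε_{n+1}‖²` for a predictor `X̂` of `X_{n+1}`. -/
def excessError (ε X : ℤ → Lp H 2 P) (pred : ℕ → Lp H 2 P) (n : ℕ) : ℝ :=
  ∫ ω, ‖(X (n + 1) - pred n - ε (n + 1) : Lp H 2 P) ω‖ ^ 2 ∂P

/-- `∑_{j > m_n} ‖π_j‖ + ∑_{j > d_{n - m_n}} λ_j`. The eigenvalues are indexed from `0`, so that
the second sum is over the indices `j ≥ d_{n - m_n}`. -/
def rateBound (π : ℕ → H →L[ℝ] H) (lam : ℕ → ℝ) (m d : ℕ → ℕ) (n : ℕ) : ℝ :=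
  (∑' j : Set.Ioi (m n), ‖π j‖) + ∑' j : Set.Ici (d (n - m n)), lam j

/-! ### Spectral density matrices of the projected vector processes -/

/-- The lag `h` covariance matrix `E[𝐗_h 𝐗_0ᵀ]` of the `D`-dimensional process
`𝐗_n = (⟨X_n, ν_1⟩, …, ⟨X_n, ν_D⟩)ᵀ`. -/
def covMatrix (ν : HilbertBasis ℕ ℝ H) (X : ℤ → Lp H 2 P) (D : ℕ) (h : ℤ) :
    Matrix (Fin D) (Fin D) ℝ :=
  Matrix.of fun k l => ∫ ω, inner ℝ (X h ω) (ν k) * inner ℝ (X 0 ω) (ν l) ∂P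

/-- The summand `e^{-ihω} C_{𝐗_D;h}` of the spectral density matrix. -/
def spectralTerm (ν : HilbertBasis ℕ ℝ H) (X : ℤ → Lp H 2 P) (D : ℕ) (ω : ℝ) (h : ℤ) :
    Matrix (Fin D) (Fin D) ℂ :=
  Complex.exp (-Complex.I * h * ω) • (covMatrix ν X D h).map (fun a : ℝ => (a : ℂ))

/-- The spectral density matrix `f[ω] = (2π)⁻¹ ∑_{h ∈ ℤ} e^{-ihω} C_{𝐗_D;h}`. -/
def spectralDensity (ν : HilbertBasis ℕ ℝ H) (X : ℤ → Lp H 2 P) (D : ℕ) (ω : ℝ) :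
    Matrix (Fin D) (Fin D) ℂ :=
  (1 / (2 * Real.pi) : ℂ) • ∑' h : ℤ, spectralTerm ν X D ω h

/-- The infimum `α_D` of the (real) eigenvalues of `f[ω]` over all `-π < ω ≤ π`. -/
def alpha (ν : HilbertBasis ℕ ℝ H) (X : ℤ → Lp H 2 P) (D : ℕ) : ℝ :=
  sInf {a : ℝ | ∃ ω ∈ Set.Ioc (-Real.pi) Real.pi,
    Module.End.HasEigenvalue (Matrix.toLin' (spectralDensity ν X D ω)) (a : ℂ)}

end

end FunctionalLinearProcess

open FunctionalLinearProcess

/-!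
Best linear prediction of an invertible functional linear process from its projections on increasing
finite-dimensional spaces, and the innovations algorithm that computes it.

Random elements are handled through the cross covariance operator, a bounded bilinear function on
`L²_H`; uncorrelated elements are orthogonal (`inner_eq_zero_of_crossCov_eq_zero`), and the elements
uncorrelated with a given one form a closed subspace stable under bounded operators, hence contain
the `ℒ`-closed subspace generated by any of their subsets.

*Rates.* Since `ε_{n+1}` is uncorrelated with the past, the excess error of the best predictor is
the squared distance of `X_{n+1} - ε_{n+1}` to the projected past, so it is at most the squared distance
to the truncated autoregression `∑_{j ≤ m} π_j X_{d_{n+1-j},n+1-j}`, which the triangle inequality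
and Parseval's identity estimate (`norm_sub_truncatedPredictor_le`). The algorithm is a Gram–Schmidt
procedure (`innovations_algorithm`): its innovations `e_k` are mutually uncorrelated and have the
covariance operators `V_k`, which are invertible on `A_{d_{k+1}}` because their quadratic forms dominate that of `C_ε`.
Hence its output is the projection of `X_{d_{n+1},n+1}` on the same space, and differs from the best
predictor by the tail of the eigenvalues at most (`exists_error_bounds`).

*Spectral bound.* Comparing cross covariances with the noise gives `ψ_n = ∑ π_j ψ_{n-j}`; as formal
power series over the noncommutative ring of operators, `(I - ∑ π_j z^j)` and `∑ ψ_j z^j` are then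
two-sided inverses. Up to a factor, the spectral density matrix is the Gram matrix of the coordinate
functionals transformed by the transfer function of `ψ` and evaluated at the noise. The transfer
function is injective and the noise annihilates no functional, so the matrix is positive definite
(`posDef_spectralDensity`); compactness makes the spectral bound `α_D` positive (`alpha_pos`), and
Fourier inversion turns it into a lower bound for the variances of linear combinations of
observations (`alpha_mul_sum_le`), in particular `V_k ≥ 2π α_{d_n}` on `A_{d_{k+1}}` for `k < n`.

*Coefficients.* Let `Γ_{n,i} = θ_{n,i} - ∑_{j=1}^i π_j θ_{n-j,i-j}`, where `θ_{n,0}` is the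
projection on `A_{d_{n+1}}`. The cross covariance operator of `e_{n-i}` with the difference of the
output of the algorithm and the truncated autoregression is `Γ_{n,i} V_{n-i}`. The difference has
squared norm `O(R_n)`, so the lower bound for `V_{n-i}` gives `‖Γ_{n,i}‖² = O(R_n / α_{d_n})`
(`alpha_mul_norm_recursionDefect_le`). As `ψ` satisfies the recursion without defect, strong
convergence follows by induction on `i` (`tendsto_thetaExt`).
-/

namespace FunctionalLinearProcess

section CrossCovariance

variable {Ω : Type*} [MeasurableSpace Ω] {P : Measure Ω}
variable {H : Type*} [NormedAddCommGroup H] [InnerProductSpace ℝ H]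
variable {F G : Type*} [NormedAddCommGroup F] [NormedSpace ℝ F]
  [NormedAddCommGroup G] [NormedSpace ℝ G]

/-! ### Bounded operators acting on square integrable random elements -/

theorem comp_compLp (l : F →L[ℝ] G) (r : H →L[ℝ] F) (Y : Lp H 2 P) :
    (l ∘L r).compLp Y = l.compLp (r.compLp Y) := by
  ext1
  filter_upwards [(l ∘L r).coeFn_compLp Y, l.coeFn_compLp (r.compLp Y), r.coeFn_compLp Y]
    with ω h1 h2 h3
  simp [h1, h2, h3]

theorem compLp_sub_right (l : H →L[ℝ] F) (Y Z : Lp H 2 P) :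
    l.compLp (Y - Z) = l.compLp Y - l.compLp Z := map_sub (l.compLpL 2 P) Y Z

theorem compLp_add_right (l : H →L[ℝ] F) (Y Z : Lp H 2 P) :
    l.compLp (Y + Z) = l.compLp Y + l.compLp Z := map_add (l.compLpL 2 P) Y Z

theorem compLp_sum_right {ι : Type*} (l : H →L[ℝ] F) (s : Finset ι) (Y : ι → Lp H 2 P) :
    l.compLp (∑ i ∈ s, Y i) = ∑ i ∈ s, l.compLp (Y i) := map_sum (l.compLpL 2 P) Y s

theorem compLp_hasSum {ι : Type*} (l : H →L[ℝ] F) {Y : ι → Lp H 2 P} {Z : Lp H 2 P}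
    (h : HasSum Y Z) : HasSum (fun i => l.compLp (Y i)) (l.compLp Z) :=
  (l.compLpL 2 P).hasSum h

/-- For fixed `Y`, the bounded linear map `l ↦ l Y` from bounded operators to square integrable
random elements. -/
noncomputable def evalOn (Y : Lp H 2 P) : (H →L[ℝ] F) →L[ℝ] Lp F 2 P :=
  (ContinuousLinearMap.compLpL₂ 2 P (ContinuousLinearMap.id ℝ (H →L[ℝ] F))).flip Y

theorem evalOn_apply (Y : Lp H 2 P) (l : H →L[ℝ] F) : evalOn Y l = l.compLp Y := rfl

theorem compLp_sub_left (l r : H →L[ℝ] F) (Y : Lp H 2 P) :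
    (l - r).compLp Y = l.compLp Y - r.compLp Y := map_sub (evalOn Y) l r

theorem compLp_sum_left {ι : Type*} (s : Finset ι) (l : ι → H →L[ℝ] F) (Y : Lp H 2 P) :
    (∑ i ∈ s, l i).compLp Y = ∑ i ∈ s, (l i).compLp Y := map_sum (evalOn Y) l s

theorem id_compLp (Y : Lp H 2 P) : (ContinuousLinearMap.id ℝ H).compLp Y = Y := by
  ext1
  filter_upwards [(ContinuousLinearMap.id ℝ H).coeFn_compLp Y] with ω h
  simp [h]

/-! ### Cross covariance operators -/

theorem integrable_rankOne (Y Z : Lp H 2 P) :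
    Integrable (fun ω => InnerProductSpace.rankOne ℝ (Z ω) (Y ω)) P := by
  have hm : AEStronglyMeasurable (fun ω => InnerProductSpace.rankOne ℝ (Z ω) (Y ω)) P := by
    have hY : AEStronglyMeasurable (fun ω => innerSL ℝ (Y ω)) P :=
      (innerSL ℝ (E := H)).continuous.comp_aestronglyMeasurable (Lp.aestronglyMeasurable Y)
    exact (ContinuousLinearMap.smulRightL ℝ H H).aestronglyMeasurable_comp₂ hY
      (Lp.aestronglyMeasurable Z)
  have h : Integrable (fun ω => ‖Z ω‖ * ‖Y ω‖) P :=
    (Lp.memLp Z).norm.integrable_mul (Lp.memLp Y).norm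
  exact h.mono' hm (ae_of_all _ fun ω => (InnerProductSpace.norm_rankOne _ _).le)

theorem integrable_inner_smul (Y Z : Lp H 2 P) (x : H) :
    Integrable (fun ω => inner ℝ (Y ω) x • Z ω) P :=
  (integrable_rankOne Y Z).apply_continuousLinearMap x

theorem coeFn_innerSL_compLp (x : H) (Y : Lp H 2 P) :
    (innerSL ℝ x).compLp Y =ᵐ[P] fun ω => inner ℝ (Y ω) x := by
  filter_upwards [(innerSL ℝ x).coeFn_compLp Y] with ω h
  rw [h, innerSL_apply_apply, real_inner_comm]

theorem ext_inner_clm {A B : H →L[ℝ] H} (h : ∀ x y, inner ℝ (A x) y = inner ℝ (B x) y) : A = B :=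
  ContinuousLinearMap.ext fun x => ext_inner_right ℝ (h x)

theorem lcs_le {S : Set (Lp H 2 P)} {G : Submodule ℝ (Lp H 2 P)}
    (hG : IsClosed (G : Set (Lp H 2 P)))
    (hl : ∀ (l : H →L[ℝ] H), ∀ Z ∈ G, l.compLp Z ∈ G) (hS : S ⊆ G) : lcs S ≤ G :=
  sInf_le ⟨hG, hl, hS⟩

theorem subset_lcs (S : Set (Lp H 2 P)) : S ⊆ lcs S := by
  intro Z hZ
  rw [SetLike.mem_coe, lcs, Submodule.mem_sInf]
  exact fun G hG => hG.2.2 hZ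

theorem compLp_mem_lcs {S : Set (Lp H 2 P)} (l : H →L[ℝ] H) {Z : Lp H 2 P} (hZ : Z ∈ lcs S) :
    l.compLp Z ∈ lcs S := by
  rw [lcs, Submodule.mem_sInf] at hZ ⊢
  exact fun G hG => hG.2.1 l Z (hZ G hG)

theorem norm_sq_eq_integral (Y : Lp H 2 P) : ‖Y‖ ^ 2 = ∫ ω, ‖Y ω‖ ^ 2 ∂P := by
  rw [← real_inner_self_eq_norm_sq, L2.inner_def]
  simp only [real_inner_self_eq_norm_sq]

theorem crossCov_apply (Y Z : Lp H 2 P) (x : H) :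
    crossCov Y Z x = ∫ ω, inner ℝ (Y ω) x • Z ω ∂P := by
  rw [crossCov, ContinuousLinearMap.integral_apply (integrable_rankOne Y Z)]
  rfl

variable [CompleteSpace H]

theorem inner_crossCov (Y Z : Lp H 2 P) (x y : H) :
    inner ℝ (crossCov Y Z x) y = ∫ ω, inner ℝ (Y ω) x * inner ℝ (Z ω) y ∂P := by
  rw [crossCov_apply, real_inner_comm, ← integral_inner (integrable_inner_smul Y Z x)]
  simp [inner_smul_right, real_inner_comm]

/-- The cross covariance operator in terms of the inner product of real random variables. -/
theorem inner_crossCov_eq_inner (Y Z : Lp H 2 P) (x y : H) :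
    inner ℝ (crossCov Y Z x) y
      = inner ℝ ((innerSL ℝ x).compLp Y) ((innerSL ℝ y).compLp Z) := by
  rw [inner_crossCov, L2.inner_def]
  refine integral_congr_ae ?_
  filter_upwards [coeFn_innerSL_compLp x Y, coeFn_innerSL_compLp y Z] with ω h1 h2
  simp [h1, h2, mul_comm]

theorem crossCov_add_right (Y Z W : Lp H 2 P) :
    crossCov Y (Z + W) = crossCov Y Z + crossCov Y W := by
  refine ext_inner_clm fun x y => ?_
  simp only [_root_.add_apply, inner_add_left, inner_crossCov_eq_inner,
    compLp_add_right, inner_add_right]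

theorem adjoint_crossCov (Y Z : Lp H 2 P) :
    ContinuousLinearMap.adjoint (crossCov Y Z) = crossCov Z Y := by
  refine ext_inner_clm fun x y => ?_
  rw [ContinuousLinearMap.adjoint_inner_left, real_inner_comm, inner_crossCov_eq_inner,
    inner_crossCov_eq_inner, real_inner_comm]

theorem crossCov_compLp (l r : H →L[ℝ] H) (Y Z : Lp H 2 P) :
    crossCov (l.compLp Y) (r.compLp Z)
      = r ∘L crossCov Y Z ∘L ContinuousLinearMap.adjoint l := by
  refine ext_inner_clm fun x y => ?_
  simp only [ContinuousLinearMap.comp_apply]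
  rw [← ContinuousLinearMap.adjoint_inner_right r, inner_crossCov_eq_inner,
    inner_crossCov_eq_inner, ← comp_compLp, ← comp_compLp,
    ContinuousLinearMap.innerSL_apply_comp,
    ContinuousLinearMap.innerSL_apply_comp]

theorem crossCov_compLp_right (r : H →L[ℝ] H) (Y Z : Lp H 2 P) :
    crossCov Y (r.compLp Z) = r ∘L crossCov Y Z := by
  conv_lhs => rw [← id_compLp Y, crossCov_compLp]
  rw [← ContinuousLinearMap.one_def, ← ContinuousLinearMap.star_eq_adjoint, star_one]
  rfl

theorem crossCov_compLp_left (l : H →L[ℝ] H) (Y Z : Lp H 2 P) :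
    crossCov (l.compLp Y) Z = crossCov Y Z ∘L ContinuousLinearMap.adjoint l := by
  conv_lhs => rw [← id_compLp Z, crossCov_compLp]
  rfl

theorem norm_crossCov_le (Y Z : Lp H 2 P) : ‖crossCov Y Z‖ ≤ ‖Y‖ * ‖Z‖ := by
  refine ContinuousLinearMap.opNorm_le_of_re_inner_le (𝕜 := ℝ) (by positivity) fun x y hx hy => ?_
  have h (z : H) (hz : ‖z‖ = 1) (W : Lp H 2 P) : ‖(innerSL ℝ z).compLp W‖ ≤ ‖W‖ := by
    have := ContinuousLinearMap.norm_compLp_le (innerSL ℝ z) W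
    rwa [innerSL_apply_norm, hz, one_mul] at this
  rw [RCLike.re_to_real, inner_crossCov_eq_inner]
  exact (real_inner_le_norm _ _).trans (mul_le_mul (h x hx Y) (h y hy Z) (norm_nonneg _)
    (norm_nonneg _))

/-- For fixed `Y`, the cross covariance operator as a bounded linear map of the second argument. -/
noncomputable def crossCovL (Y : Lp H 2 P) : Lp H 2 P →L[ℝ] (H →L[ℝ] H) :=
  LinearMap.mkContinuous
    { toFun := crossCov Y
      map_add' := crossCov_add_right Y
      map_smul' := fun c Z => by
        refine ext_inner_clm fun x y => ?_
        have h : (innerSL ℝ y).compLp (c • Z) = c • (innerSL ℝ y).compLp Z :=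
          map_smul ((innerSL ℝ y).compLpL 2 P) c Z
        simp only [RingHom.id_apply, _root_.smul_apply, inner_smul_left,
          inner_crossCov_eq_inner, h, inner_smul_right]
        rfl }
    ‖Y‖ (norm_crossCov_le Y)

theorem crossCov_sub_right (Y Z W : Lp H 2 P) :
    crossCov Y (Z - W) = crossCov Y Z - crossCov Y W := map_sub (crossCovL Y) Z W

theorem crossCov_sum_right {ι : Type*} (Y : Lp H 2 P) (s : Finset ι) (Z : ι → Lp H 2 P) :
    crossCov Y (∑ i ∈ s, Z i) = ∑ i ∈ s, crossCov Y (Z i) := map_sum (crossCovL Y) Z s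

theorem crossCov_hasSum_right {ι : Type*} (Y : Lp H 2 P) {Z : ι → Lp H 2 P} {W : Lp H 2 P}
    (h : HasSum Z W) : HasSum (fun i => crossCov Y (Z i)) (crossCov Y W) :=
  (crossCovL Y).hasSum h

theorem crossCov_swap_eq_zero {Y Z : Lp H 2 P} (h : crossCov Y Z = 0) : crossCov Z Y = 0 := by
  rw [← adjoint_crossCov, h, map_zero]

theorem crossCov_sub_left (Y Z W : Lp H 2 P) :
    crossCov (Y - Z) W = crossCov Y W - crossCov Z W := by
  rw [← adjoint_crossCov, crossCov_sub_right, map_sub, adjoint_crossCov, adjoint_crossCov]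

theorem crossCov_sum_left {ι : Type*} (s : Finset ι) (Z : ι → Lp H 2 P) (Y : Lp H 2 P) :
    crossCov (∑ i ∈ s, Z i) Y = ∑ i ∈ s, crossCov (Z i) Y := by
  rw [← adjoint_crossCov, crossCov_sum_right, map_sum]
  simp only [adjoint_crossCov]

/-- The random elements which are uncorrelated with `Z`, i.e. whose cross covariance operator with
`Z` vanishes. -/
noncomputable def uncorrelatedWith (Z : Lp H 2 P) : Submodule ℝ (Lp H 2 P) :=
  LinearMap.ker (crossCovL Z : Lp H 2 P →ₗ[ℝ] (H →L[ℝ] H))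

theorem mem_uncorrelatedWith {Y Z : Lp H 2 P} : Y ∈ uncorrelatedWith Z ↔ crossCov Z Y = 0 :=
  Iff.rfl

theorem isClosed_uncorrelatedWith (Z : Lp H 2 P) :
    IsClosed (uncorrelatedWith Z : Set (Lp H 2 P)) := (crossCovL Z).isClosed_ker

theorem compLp_mem_uncorrelatedWith {Y Z : Lp H 2 P} (l : H →L[ℝ] H)
    (h : Y ∈ uncorrelatedWith Z) : l.compLp Y ∈ uncorrelatedWith Z := by
  rw [mem_uncorrelatedWith] at h ⊢
  rw [crossCov_compLp_right, h, ContinuousLinearMap.comp_zero]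

theorem lcs_le_uncorrelatedWith {S : Set (Lp H 2 P)} {Z : Lp H 2 P}
    (hS : ∀ Y ∈ S, crossCov Z Y = 0) : lcs S ≤ uncorrelatedWith Z :=
  lcs_le (isClosed_uncorrelatedWith Z) (fun l _ h => compLp_mem_uncorrelatedWith l h) hS

end CrossCovariance

section Parseval

variable {Ω : Type*} [MeasurableSpace Ω] {P : Measure Ω}
variable {H : Type*} [NormedAddCommGroup H] [InnerProductSpace ℝ H]

/-! ### The projections on the spaces spanned by the first basis vectors -/

theorem basisSpan_mono (ν : HilbertBasis ℕ ℝ H) : Monotone (basisSpan ν) := fun _ _ h =>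
  Submodule.span_mono (Set.image_mono fun _ hi => lt_of_lt_of_le hi h)

theorem apply_mem_basisSpan (ν : HilbertBasis ℕ ℝ H) {k D : ℕ} (h : k < D) :
    ν k ∈ basisSpan ν D := Submodule.subset_span ⟨k, h, rfl⟩

theorem proj_mem (ν : HilbertBasis ℕ ℝ H) (D : ℕ) (x : H) : proj ν D x ∈ basisSpan ν D :=
  Submodule.starProjection_apply_mem _ _

theorem proj_eq_self_iff {ν : HilbertBasis ℕ ℝ H} {D : ℕ} {x : H} :
    proj ν D x = x ↔ x ∈ basisSpan ν D := Submodule.starProjection_eq_self_iff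

theorem proj_proj (ν : HilbertBasis ℕ ℝ H) (D : ℕ) (x : H) : proj ν D (proj ν D x) = proj ν D x :=
  proj_eq_self_iff.2 (proj_mem ν D x)

theorem proj_comp_proj (ν : HilbertBasis ℕ ℝ H) (D : ℕ) : proj ν D ∘L proj ν D = proj ν D :=
  ContinuousLinearMap.ext fun x => proj_proj ν D x

theorem inner_proj_left (ν : HilbertBasis ℕ ℝ H) (D : ℕ) (x y : H) :
    inner ℝ (proj ν D x) y = inner ℝ x (proj ν D y) :=
  Submodule.inner_starProjection_left_eq_right _ _ _

theorem adjoint_proj [CompleteSpace H] (ν : HilbertBasis ℕ ℝ H) (D : ℕ) :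
    ContinuousLinearMap.adjoint (proj ν D) = proj ν D :=
  isSelfAdjoint_starProjection _

theorem mem_orthogonal_basisSpan {ν : HilbertBasis ℕ ℝ H} {D : ℕ} {x : H}
    (h : ∀ k < D, inner ℝ (ν k) x = 0) : x ∈ (basisSpan ν D)ᗮ := by
  have hle : basisSpan ν D ≤ LinearMap.ker (innerSL ℝ x : H →ₗ[ℝ] ℝ) := by
    refine Submodule.span_le.2 ?_
    rintro _ ⟨k, hk, rfl⟩
    simpa [real_inner_comm] using h k hk
  refine (Submodule.mem_orthogonal' _ _).2 fun u hu => ?_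
  simpa using hle hu

theorem proj_apply_basis_of_lt (ν : HilbertBasis ℕ ℝ H) {k D : ℕ} (h : k < D) :
    proj ν D (ν k) = ν k := proj_eq_self_iff.2 (apply_mem_basisSpan ν h)

theorem proj_apply_basis_of_le (ν : HilbertBasis ℕ ℝ H) {k D : ℕ} (h : D ≤ k) :
    proj ν D (ν k) = 0 := by
  refine (Submodule.starProjection_apply_eq_zero_iff _).2 (mem_orthogonal_basisSpan fun j hj => ?_)
  exact ν.orthonormal.2 (by omega)

theorem sum_inner_smul_of_mem {ν : HilbertBasis ℕ ℝ H} {D : ℕ} {x : H} (hx : x ∈ basisSpan ν D) :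
    ∑ k : Fin D, inner ℝ (ν k) x • ν k = x := by
  have h1 := ν.hasSum_repr x
  simp only [HilbertBasis.repr_apply_apply] at h1
  have h2 : HasSum (fun k => inner ℝ (ν k) x • ν k)
      (∑ k ∈ Finset.range D, inner ℝ (ν k) x • ν k) := by
    refine hasSum_sum_of_ne_finset_zero fun k hk => ?_
    rw [← proj_eq_self_iff.2 hx, ← inner_proj_left,
      proj_apply_basis_of_le ν (by simpa using hk), inner_zero_left, zero_smul]
  rw [Fin.sum_univ_eq_sum_range (fun k => inner ℝ (ν k) x • ν k) D]
  exact h2.unique h1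

theorem norm_sq_of_mem_basisSpan {ν : HilbertBasis ℕ ℝ H} {D : ℕ} {x : H}
    (hx : x ∈ basisSpan ν D) : ‖x‖ ^ 2 = ∑ k : Fin D, inner ℝ (ν k) x ^ 2 := by
  conv_lhs => rw [← real_inner_self_eq_norm_sq, ← sum_inner_smul_of_mem hx, sum_inner]
  refine Finset.sum_congr rfl fun k _ => ?_
  rw [inner_smul_left, sum_inner_smul_of_mem hx, sq]
  rfl

theorem tendsto_proj (ν : HilbertBasis ℕ ℝ H) (x : H) :
    Tendsto (fun D => proj ν D x) atTop (𝓝 x) := by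
  refine Submodule.starProjection_tendsto_self _ (basisSpan_mono ν) x ?_
  rw [← ν.dense_span]
  refine Submodule.topologicalClosure_mono (Submodule.span_le.2 ?_)
  rintro _ ⟨k, rfl⟩
  exact (le_iSup (basisSpan ν) (k + 1)) (apply_mem_basisSpan ν (Nat.lt_succ_self k))

theorem proj_eq_sum_rankOne (ν : HilbertBasis ℕ ℝ H) (D : ℕ) :
    proj ν D = ∑ k : Fin D, InnerProductSpace.rankOne ℝ (ν k) (ν k) := by
  ext x
  rw [← sum_inner_smul_of_mem (proj_mem ν D x), _root_.sum_apply]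
  refine Finset.sum_congr rfl fun k _ => ?_
  rw [← inner_proj_left, proj_apply_basis_of_lt ν k.2]
  rfl

theorem tsum_Ici_eq_sub {f : ℕ → ℝ} (hf : Summable f) (D : ℕ) :
    ∑' k : Set.Ici D, f k = ∑' k, f k - ∑ k ∈ Finset.range D, f k := by
  have h := hf.sum_add_tsum_compl (s := Finset.range D)
  have hs : ((Finset.range D : Finset ℕ) : Set ℕ)ᶜ = Set.Ici D := by
    ext k
    simp
  rw [hs] at h
  linarith

theorem tendsto_tsum_Ici {f : ℕ → ℝ} (hf : Summable f) :
    Tendsto (fun D : ℕ => ∑' k : Set.Ici D, f (k : ℕ)) atTop (𝓝 0) := by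
  simp only [tsum_Ici_eq_sub hf]
  simpa using hf.hasSum.tendsto_sum_nat.const_sub (∑' k, f k)

/-! ### Parseval's identity for random elements -/

theorem hasSum_norm_innerSL_compLp_sq [CompleteSpace H] (ν : HilbertBasis ℕ ℝ H) (Y : Lp H 2 P) :
    HasSum (fun k => ‖(innerSL ℝ (ν k)).compLp Y‖ ^ 2) (‖Y‖ ^ 2) := by
  have hpt (x : H) : HasSum (fun k => inner ℝ x (ν k) ^ 2) (‖x‖ ^ 2) := by
    have := ν.hasSum_inner_mul_inner x x
    rw [real_inner_self_eq_norm_sq] at this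
    simpa [sq, real_inner_comm] using this
  have hint : Integrable (fun ω => ‖Y ω‖ ^ 2) P := (Lp.memLp Y).integrable_norm_pow two_ne_zero
  have h := hasSum_integral_of_dominated_convergence (μ := P)
    (F := fun k ω => inner ℝ (Y ω) (ν k) ^ 2) (f := fun ω => ‖Y ω‖ ^ 2)
    (fun k ω => inner ℝ (Y ω) (ν k) ^ 2)
    (fun k => ((Lp.aestronglyMeasurable Y).inner_const).pow 2)
    (fun k => ae_of_all _ fun ω => by simp)
    (ae_of_all _ fun ω => (hpt _).summable)
    (by simpa only [(hpt _).tsum_eq] using hint)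
    (ae_of_all _ fun ω => hpt _)
  rw [norm_sq_eq_integral]
  refine h.congr_fun fun k => ?_
  rw [norm_sq_eq_integral]
  refine integral_congr_ae ?_
  filter_upwards [coeFn_innerSL_compLp (ν k) Y] with ω h1
  rw [h1, Real.norm_eq_abs, sq_abs]

theorem norm_sub_proj_sq [CompleteSpace H] (ν : HilbertBasis ℕ ℝ H) (D : ℕ) (Y : Lp H 2 P) :
    ‖Y - (proj ν D).compLp Y‖ ^ 2
      = ∑' k : Set.Ici D, ‖(innerSL ℝ (ν k)).compLp Y‖ ^ 2 := by
  rw [← (hasSum_norm_innerSL_compLp_sq ν _).tsum_eq, tsum_subtype (Set.Ici D)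
    (fun k => ‖(innerSL ℝ (ν k)).compLp Y‖ ^ 2)]
  refine tsum_congr fun k => ?_
  have h : (innerSL ℝ (ν k)).compLp (Y - (proj ν D).compLp Y)
      = (innerSL ℝ (ν k)).compLp Y - (innerSL ℝ (proj ν D (ν k))).compLp Y := by
    rw [compLp_sub_right, ← comp_compLp, ContinuousLinearMap.innerSL_apply_comp, adjoint_proj]
  rw [h]
  by_cases hk : D ≤ k
  · rw [proj_apply_basis_of_le ν hk, map_zero, Set.indicator_of_mem (Set.mem_Ici.2 hk),
      ← evalOn_apply _ 0, map_zero, sub_zero]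
  · rw [proj_apply_basis_of_lt ν (not_le.1 hk), sub_self,
      Set.indicator_of_notMem (by simpa using hk)]
    simp

theorem tendsto_proj_compLp [CompleteSpace H] (ν : HilbertBasis ℕ ℝ H) (Y : Lp H 2 P) :
    Tendsto (fun D => (proj ν D).compLp Y) atTop (𝓝 Y) := by
  have h := (hasSum_norm_innerSL_compLp_sq ν Y).summable
  have h1 : Tendsto (fun D => ‖Y - (proj ν D).compLp Y‖ ^ 2) atTop (𝓝 0) := by
    simpa only [norm_sub_proj_sq] using tendsto_tsum_Ici h
  rw [tendsto_iff_norm_sub_tendsto_zero]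
  have h2 := h1.sqrt
  simpa [norm_sub_rev] using h2

/-- Uncorrelated random elements are orthogonal in `L²_H`. -/
theorem inner_eq_zero_of_crossCov_eq_zero [CompleteSpace H] (ν : HilbertBasis ℕ ℝ H)
    {Y Z : Lp H 2 P} (h : crossCov Y Z = 0) : inner ℝ Y Z = 0 := by
  have h1 : Tendsto (fun D => inner ℝ ((proj ν D).compLp Y) Z) atTop (𝓝 (inner ℝ Y Z)) :=
    (tendsto_proj_compLp ν Y).inner tendsto_const_nhds
  refine tendsto_nhds_unique h1 (tendsto_const_nhds.congr fun D => ?_)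
  rw [proj_eq_sum_rankOne, compLp_sum_left, sum_inner]
  refine (Finset.sum_eq_zero fun k _ => ?_).symm
  have h2 : inner ℝ (crossCov Y Z (ν k)) (ν k) = 0 := by simp [h]
  rw [← h2, inner_crossCov, L2.inner_def]
  refine integral_congr_ae ?_
  filter_upwards [(InnerProductSpace.rankOne ℝ (ν k) (ν k)).coeFn_compLp Y] with ω h3
  rw [h3, InnerProductSpace.rankOne_apply, real_inner_smul_left, real_inner_comm (ν k),
    real_inner_comm (ν k) (Z ω)]

end Parseval

section LinearProcess

variable {Ω : Type*} [MeasurableSpace Ω] {P : Measure Ω}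
variable {H : Type*} [NormedAddCommGroup H] [InnerProductSpace ℝ H]
variable {ε X : ℤ → Lp H 2 P} {ψ π : ℕ → H →L[ℝ] H}

/-! ### Moving average and autoregressive coefficients -/

/-- The coefficients of the autoregressive power series `I - ∑_{j ≥ 1} π_j z^j`; the value `π 0` is
not used. -/
noncomputable def arCoeff (π : ℕ → H →L[ℝ] H) (n : ℕ) : H →L[ℝ] H := if n = 0 then 1 else -π n

/-- By the recursion, the autoregressive power series is a left inverse of the moving average power
series. It is a right inverse as well, because a power series with constant coefficient `1` over a
noncommutative ring is a unit. -/
theorem sum_coeff_mul_arCoeff (h0 : ψ 0 = 1)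
    (hrec : ∀ n, 0 < n → ψ n = ∑ j ∈ Finset.range n, π (j + 1) ∘L ψ (n - (j + 1))) (n : ℕ) :
    ∑ p ∈ Finset.HasAntidiagonal.antidiagonal n, ψ p.1 * arCoeff π p.2
      = if n = 0 then 1 else 0 := by
  have hl : PowerSeries.mk (arCoeff π) * PowerSeries.mk ψ = 1 := by
    ext1 k
    rw [PowerSeries.coeff_mul, PowerSeries.coeff_one]
    simp only [PowerSeries.coeff_mk]
    rcases Nat.eq_zero_or_pos k with rfl | hk
    · simp [arCoeff, h0]
    · obtain ⟨k, rfl⟩ := Nat.exists_eq_succ_of_ne_zero hk.ne'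
      rw [Finset.Nat.antidiagonal_succ, Finset.sum_cons, Finset.sum_map,
        Finset.Nat.sum_antidiagonal_eq_sum_range_succ_mk, if_neg hk.ne']
      have := hrec _ hk
      simp only [arCoeff, if_true, one_mul, Function.Embedding.prodMap, Function.Embedding.coeFn_mk,
        Prod.map_apply, Function.Embedding.refl_apply, Nat.succ_ne_zero, if_false, neg_mul,
        Finset.sum_neg_distrib]
      rw [this, add_neg_eq_zero]
      refine Finset.sum_congr rfl fun j _ => ?_
      rw [Nat.succ_sub_succ]
      rfl
  have hr : PowerSeries.mk ψ * PowerSeries.mk (arCoeff π) = 1 := by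
    have hu := PowerSeries.mul_invOfUnit (PowerSeries.mk ψ) 1 (by simp [h0])
    rw [left_inv_eq_right_inv hl hu, hu]
  have := congrArg (PowerSeries.coeff n) hr
  rw [PowerSeries.coeff_mul, PowerSeries.coeff_one] at this
  simpa only [PowerSeries.coeff_mk] using this

theorem summable_norm_coeff (hinv : IsInverseRepresentation π ε X) : Summable fun j => ‖π j‖ :=
  (summable_nat_add_iff 1).1 hinv.summable_norm

theorem summable_norm_arCoeff (hπ : Summable fun j => ‖π j‖) :
    Summable fun j => ‖arCoeff π j‖ := by
  refine (summable_nat_add_iff 1).1 ?_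
  simpa [arCoeff] using (summable_nat_add_iff 1).2 hπ

theorem eq_zero_of_apply_eq_zero {C : H →L[ℝ] H}
    (hpos : ∀ a : ℝ, Module.End.HasEigenvalue (C : H →ₗ[ℝ] H) a → 0 < a) {x : H} (h : C x = 0) :
    x = 0 := by
  by_contra hx
  have : Module.End.HasEigenvalue (C : H →ₗ[ℝ] H) 0 :=
    Module.End.hasEigenvalue_of_hasEigenvector (x := x)
      ⟨by simpa [Module.End.mem_eigenspace_iff] using h, hx⟩
  exact lt_irrefl _ (hpos 0 this)

variable [CompleteSpace H]

theorem crossCov_noise_past (hε : IsWhiteNoise ε) (hX : IsLinearProcess ψ ε X) {m n : ℤ}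
    (h : n < m) : crossCov (ε m) (X n) = 0 := by
  refine (crossCov_hasSum_right (ε m) (hX.hasSum n)).unique ?_
  have h0 (j : ℕ) : crossCov (ε m) ((ψ j).compLp (ε (n - j))) = 0 := by
    rw [crossCov_compLp_right, hε.uncorrelated m (n - j) (by omega), ContinuousLinearMap.comp_zero]
  simp only [h0]
  exact hasSum_zero

theorem crossCov_noise_future (hε : IsWhiteNoise ε) (hX : IsLinearProcess ψ ε X) (m : ℤ) (k : ℕ) :
    crossCov (ε m) (X (m + k)) = ψ k ∘L crossCov (ε 0) (ε 0) := by
  refine (crossCov_hasSum_right (ε m) (hX.hasSum (m + k))).unique ?_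
  have h1 : crossCov (ε m) ((ψ k).compLp (ε (m + k - k))) = ψ k ∘L crossCov (ε 0) (ε 0) := by
    rw [crossCov_compLp_right, add_sub_cancel_right, hε.cov_eq m]
  rw [← h1]
  refine hasSum_single k fun j hj => ?_
  rw [crossCov_compLp_right, hε.uncorrelated m _ (by omega), ContinuousLinearMap.comp_zero]

theorem inner_cov_self (Y : Lp H 2 P) (x : H) :
    inner ℝ (crossCov Y Y x) x = ‖(innerSL ℝ x).compLp Y‖ ^ 2 := by
  rw [inner_crossCov_eq_inner, real_inner_self_eq_norm_sq]

theorem cov_apply_eq_zero {Y : Lp H 2 P} {x : H} (h : (innerSL ℝ x).compLp Y = 0) :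
    crossCov Y Y x = 0 := by
  refine ext_inner_right ℝ fun y => ?_
  rw [inner_crossCov_eq_inner, h, inner_zero_left, inner_zero_left]

/-- An injective self-adjoint operator has dense range, and may be cancelled on the right. -/
theorem cancel_cov {Y : Lp H 2 P} (hinj : ∀ x, crossCov Y Y x = 0 → x = 0) {A B : H →L[ℝ] H}
    (h : A ∘L crossCov Y Y = B ∘L crossCov Y Y) : A = B := by
  have h1 := congrArg ContinuousLinearMap.adjoint h
  rw [ContinuousLinearMap.adjoint_comp, ContinuousLinearMap.adjoint_comp, adjoint_crossCov] at h1
  refine (ContinuousLinearMap.adjoint (𝕜 := ℝ) (E := H) (F := H)).injective ?_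
  ext x
  have h2 := DFunLike.congr_fun h1 x
  rw [← sub_eq_zero]
  refine hinj _ ?_
  rw [map_sub, sub_eq_zero]
  exact h2

/-- The relation between the moving average and the autoregressive coefficients, obtained by
comparing the cross covariances of `ε_0` with both representations of `X_n`. -/
theorem coeff_recursion (hε : IsWhiteNoise ε) (hX : IsLinearProcess ψ ε X)
    (hinv : IsInverseRepresentation π ε X)
    (hinj : ∀ x, crossCov (ε 0) (ε 0) x = 0 → x = 0) {n : ℕ} (hn : 0 < n) :
    ψ n = ∑ j ∈ Finset.range n, π (j + 1) ∘L ψ (n - (j + 1)) := by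
  refine cancel_cov hinj ?_
  have h1 := crossCov_hasSum_right (ε 0) (hinv.hasSum n)
  have h2 : crossCov (ε 0) (X n) = ψ n ∘L crossCov (ε 0) (ε 0) := by
    simpa using crossCov_noise_future hε hX 0 n
  rw [crossCov_sub_right, hε.uncorrelated 0 n (by omega), sub_zero, h2] at h1
  refine h1.unique ?_
  rw [ContinuousLinearMap.finsetSum_comp]
  have h3 (j : ℕ) (hj : j ∈ Finset.range n) :
      (π (j + 1) ∘L ψ (n - (j + 1))) ∘L crossCov (ε 0) (ε 0)
        = crossCov (ε 0) ((π (j + 1)).compLp (X (n - (j + 1 : ℕ)))) := by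
    have hj' : j + 1 ≤ n := Finset.mem_range.1 hj
    have := crossCov_noise_future hε hX 0 (n - (j + 1))
    rw [zero_add, Nat.cast_sub hj'] at this
    rw [crossCov_compLp_right, this]
    rfl
  rw [Finset.sum_congr rfl h3]
  refine hasSum_sum_of_ne_finset_zero fun j hj => ?_
  rw [crossCov_compLp_right, crossCov_noise_past hε hX (by simp at hj; omega),
    ContinuousLinearMap.comp_zero]

end LinearProcess

section Innovations

variable {Ω : Type*} [MeasurableSpace Ω] {P : Measure Ω}
variable {H : Type*} [NormedAddCommGroup H] [InnerProductSpace ℝ H]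
variable (ν : HilbertBasis ℕ ℝ H) (d : ℕ → ℕ) (X : ℤ → Lp H 2 P)

/-! ### The projected observations -/

theorem proj_compLp_projX (k : ℕ) : (proj ν (d k)).compLp (projX ν d X k) = projX ν d X k := by
  rw [projX, ← comp_compLp, proj_comp_proj]

/-- The projected observations up to time `n`. -/
def observations (n : ℕ) : Set (Lp H 2 P) := {Z | ∃ k : ℕ, 1 ≤ k ∧ k ≤ n ∧ Z = projX ν d X k}

theorem projX_mem_lcs {k n : ℕ} (h : k < n) :
    projX ν d X (k + 1) ∈ lcs (observations ν d X n) :=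
  subset_lcs _ ⟨k + 1, by omega, by omega, rfl⟩

/-! ### The coefficients of the innovations algorithm -/

theorem invOn_comp_proj (D : ℕ) (V : H →L[ℝ] H) : invOn ν D V ∘L proj ν D = invOn ν D V := by
  ext x
  have h : (basisSpan ν D).orthogonalProjectionOnto (proj ν D x)
      = (basisSpan ν D).orthogonalProjectionOnto x :=
    Subtype.ext (proj_proj ν D x)
  simp only [invOn, ContinuousLinearMap.comp_apply, h]

/-- If `V` lives on `A_D` and is injective there, then `invOn` is a left inverse of `V` on `A_D`. -/
theorem invOn_comp_self {D : ℕ} {V : H →L[ℝ] H} (hVP : V ∘L proj ν D = V)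
    (hPV : proj ν D ∘L V = V) (hinj : ∀ x ∈ basisSpan ν D, V x = 0 → x = 0) :
    invOn ν D V ∘L V = proj ν D := by
  set A := basisSpan ν D
  set T : A →L[ℝ] A := A.orthogonalProjectionOnto ∘L V ∘L A.subtypeL with hT
  have hTV (x : A) : (T x : H) = V x := by
    have := DFunLike.congr_fun hPV (x : H)
    exact this
  have hTinj : Function.Injective (T : A →ₗ[ℝ] A) := by
    refine (injective_iff_map_eq_zero _).2 fun x hx => Subtype.ext (hinj x x.2 ?_)
    rw [← hTV]
    exact congrArg Subtype.val hx
  set e : A ≃L[ℝ] A := (LinearEquiv.ofInjectiveEndo (T : A →ₗ[ℝ] A) hTinj).toContinuousLinearEquiv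
    with he
  have heT : (e : A →L[ℝ] A) = T := by
    ext x
    rfl
  have hleft (x : A) : T.inverse (T x) = x := by
    rw [← heT, ContinuousLinearMap.inverse_equiv]
    simp
  ext x
  have h0 : V x = V (proj ν D x) := (DFunLike.congr_fun hVP x).symm
  rw [ContinuousLinearMap.comp_apply, h0]
  have h1 : A.orthogonalProjectionOnto (V (proj ν D x)) = T (A.orthogonalProjectionOnto x) := rfl
  change ((T.inverse (A.orthogonalProjectionOnto (V (proj ν D x))) : A) : H) = proj ν D x
  rw [h1, hleft]
  rfl

variable [CompleteSpace H]

theorem theta_comp_proj (C : ℤ → H →L[ℝ] H) {n k : ℕ} (h : k < n) :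
    theta C ν d n (n - k) ∘L proj ν (d (k + 1)) = theta C ν d n (n - k) := by
  rw [theta_rec C ν d h, ContinuousLinearMap.comp_assoc, invOn_comp_proj]

theorem proj_comp_theta (C : ℤ → H →L[ℝ] H) {n k : ℕ} (h : k < n) :
    proj ν (d (n + 1)) ∘L theta C ν d n (n - k) = theta C ν d n (n - k) := by
  induction k using Nat.strong_induction_on with
  | _ k ih =>
    rw [theta_rec C ν d h, ← ContinuousLinearMap.comp_assoc]
    congr 1
    rw [ContinuousLinearMap.comp_sub, ← ContinuousLinearMap.comp_assoc, proj_comp_proj,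
      ContinuousLinearMap.comp_finsetSum]
    congr 1
    refine Finset.sum_congr rfl fun j hj => ?_
    have hj' := Finset.mem_range.1 hj
    rw [← ContinuousLinearMap.comp_assoc, ih j hj' (hj'.trans h)]

/-! ### The innovations -/

/-- The innovation `X_{d_{k+1},k+1} - X̃_{k+1}` of the algorithm, where `X̃` is its output. -/
noncomputable def innovation (k : ℕ) : Lp H 2 P := projX ν d X (k + 1) - algPredictor ν d X k

theorem algPredictor_eq_sum (n : ℕ) :
    algPredictor ν d X n
      = ∑ k ∈ Finset.range n, (theta (lagCov X) ν d n (n - k)).compLp (innovation ν d X k) := by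
  rw [algPredictor, Fin.sum_univ_eq_sum_range (fun j => (theta (lagCov X) ν d n (j + 1)).compLp
    (projX ν d X (n - j) - algPredictor ν d X (n - (j + 1)))) n, ← Finset.sum_range_reflect]
  refine Finset.sum_congr rfl fun k hk => ?_
  have hk' := Finset.mem_range.1 hk
  have h1 : n - 1 - k + 1 = n - k := by omega
  have h2 : n - (n - 1 - k) = k + 1 := by omega
  have h3 : n - (n - k) = k := by omega
  rw [h1, h2, h3, innovation]

theorem proj_compLp_innovation (k : ℕ) :
    (proj ν (d (k + 1))).compLp (innovation ν d X k) = innovation ν d X k := by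
  rw [innovation, compLp_sub_right, proj_compLp_projX, algPredictor_eq_sum, compLp_sum_right]
  congr 1
  refine Finset.sum_congr rfl fun j hj => ?_
  rw [← comp_compLp, proj_comp_theta ν d _ (Finset.mem_range.1 hj)]

/-- The output of the algorithm is a finite linear combination, with operator coefficients, of the
projected observations. -/
theorem exists_algPredictor_eq (n : ℕ) : ∃ B : ℕ → H →L[ℝ] H,
    algPredictor ν d X n = ∑ t ∈ Finset.range n, (B t).compLp (projX ν d X (t + 1)) := by
  induction n using Nat.strong_induction_on with
  | _ n ih =>
    choose! B hB using ih
    refine ⟨fun t => theta (lagCov X) ν d n (n - t) - ∑ k ∈ Finset.range n,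
      if t < k then theta (lagCov X) ν d n (n - k) ∘L B k t else 0, ?_⟩
    simp only [compLp_sub_left, Finset.sum_sub_distrib, compLp_sum_left]
    rw [algPredictor_eq_sum, Finset.sum_comm]
    rw [← Finset.sum_sub_distrib]
    refine Finset.sum_congr rfl fun k hk => ?_
    have hk' := Finset.mem_range.1 hk
    rw [innovation, compLp_sub_right, hB k hk', compLp_sum_right]
    congr 1
    rw [← Finset.sum_subset (Finset.range_mono hk'.le)]
    · refine Finset.sum_congr rfl fun t ht => ?_
      rw [if_pos (Finset.mem_range.1 ht), comp_compLp]
    · intro t _ ht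
      rw [if_neg (by simpa using ht)]
      exact map_zero (evalOn _)

theorem algPredictor_mem_lcs (n : ℕ) : algPredictor ν d X n ∈ lcs (observations ν d X n) := by
  obtain ⟨B, hB⟩ := exists_algPredictor_eq ν d X n
  rw [hB]
  exact Submodule.sum_mem _ fun t ht =>
    compLp_mem_lcs _ (projX_mem_lcs ν d X (Finset.mem_range.1 ht))

variable {ν d X} {ε : ℤ → Lp H 2 P} {ψ : ℕ → H →L[ℝ] H}

theorem lcs_observations_le (hε : IsWhiteNoise ε) (hX : IsLinearProcess ψ ε X) (n : ℕ) :
    lcs (observations ν d X n) ≤ uncorrelatedWith (ε (n + 1)) := by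
  refine lcs_le_uncorrelatedWith ?_
  rintro _ ⟨k, _, hk, rfl⟩
  rw [projX, crossCov_compLp_right, crossCov_noise_past hε hX (by omega),
    ContinuousLinearMap.comp_zero]

/-- The variances of the innovations dominate those of the white noise, because the white noise at
time `k + 1` is uncorrelated with the other part of the innovation. -/
theorem norm_noise_le_norm_innovation (hε : IsWhiteNoise ε) (hX : IsLinearProcess ψ ε X) (k : ℕ)
    {x : H} (hx : x ∈ basisSpan ν (d (k + 1))) :
    ‖(innerSL ℝ x).compLp (ε (k + 1))‖ ^ 2 ≤ ‖(innerSL ℝ x).compLp (innovation ν d X k)‖ ^ 2 := by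
  set R := X (k + 1) - ε (k + 1) - algPredictor ν d X k with hR
  have hxP : innerSL ℝ x ∘L proj ν (d (k + 1)) = innerSL ℝ x := by
    rw [ContinuousLinearMap.innerSL_apply_comp, adjoint_proj, proj_eq_self_iff.2 hx]
  have h1 : (innerSL ℝ x).compLp (innovation ν d X k)
      = (innerSL ℝ x).compLp (ε (k + 1)) + (innerSL ℝ x).compLp R := by
    rw [← compLp_add_right, hR, innovation, projX, compLp_sub_right, ← comp_compLp, hxP,
      ← compLp_sub_right]
    congr 1
    push_cast
    abel
  have h2 : crossCov (ε (k + 1)) R = 0 := by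
    have h3 : crossCov (ε (k + 1)) (algPredictor ν d X k) = 0 :=
      lcs_observations_le hε hX k (algPredictor_mem_lcs ν d X k)
    have h4 := crossCov_noise_future hε hX (k + 1) 0
    rw [hX.coeff_zero, Nat.cast_zero, add_zero, ContinuousLinearMap.id_comp] at h4
    rw [hR, crossCov_sub_right, crossCov_sub_right, h3, h4, hε.cov_eq (k + 1), sub_self, sub_zero]
  have h5 : inner ℝ ((innerSL ℝ x).compLp (ε (k + 1))) ((innerSL ℝ x).compLp R) = 0 := by
    rw [← inner_crossCov_eq_inner, h2]
    simp
  rw [h1, norm_add_sq_real, h5]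
  nlinarith [sq_nonneg ‖(innerSL ℝ x).compLp R‖]

theorem cov_innovation_injOn (hε : IsWhiteNoise ε) (hX : IsLinearProcess ψ ε X)
    (hinj : ∀ x, crossCov (ε 0) (ε 0) x = 0 → x = 0) (k : ℕ) {x : H}
    (hx : x ∈ basisSpan ν (d (k + 1)))
    (h : crossCov (innovation ν d X k) (innovation ν d X k) x = 0) : x = 0 := by
  have h1 := norm_noise_le_norm_innovation hε hX k hx
  rw [← inner_cov_self (innovation ν d X k), h, inner_zero_left] at h1
  refine hinj x ?_
  rw [← hε.cov_eq (k + 1)]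
  refine cov_apply_eq_zero ?_
  rw [← norm_eq_zero]
  nlinarith [norm_nonneg ((innerSL ℝ x).compLp (ε (k + 1)))]

theorem crossCov_projX (hstat : IsWeaklyStationary X) (k n : ℕ) :
    crossCov (projX ν d X k) (projX ν d X n)
      = proj ν (d n) ∘L lagCov X (n - k) ∘L proj ν (d k) := by
  rw [projX, projX, crossCov_compLp, adjoint_proj, lagCov, ← hstat.cov_eq k]
  congr 4
  ring

/-- Correctness of the innovations algorithm: the operators `V_n` are the covariance operators of
the innovations, which are mutually uncorrelated, and `θ_{n,n-k} V_k` is the cross covariance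
operator of the `k`-th innovation and the next projected observation. -/
theorem innovations_algorithm (hε : IsWhiteNoise ε) (hX : IsLinearProcess ψ ε X)
    (hstat : IsWeaklyStationary X)
    (hinj : ∀ x, crossCov (ε 0) (ε 0) x = 0 → x = 0) (n : ℕ) :
    (∀ k < n, theta (lagCov X) ν d n (n - k) ∘L errorCov (lagCov X) ν d k
        = crossCov (innovation ν d X k) (projX ν d X (n + 1))) ∧
      (∀ k < n, crossCov (innovation ν d X k) (innovation ν d X n) = 0) ∧
      errorCov (lagCov X) ν d n = crossCov (innovation ν d X n) (innovation ν d X n) := by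
  induction n using Nat.strong_induction_on with
  | _ n ih =>
    set θ := theta (lagCov X) ν d with hθ
    set V := errorCov (lagCov X) ν d with hV
    set e := innovation ν d X with he
    have hVe (k : ℕ) (hk : k < n) : V k = crossCov (e k) (e k) := (ih k hk).2.2
    have hun (j k : ℕ) (hj : j < n) (hk : k < n) (hjk : j ≠ k) : crossCov (e j) (e k) = 0 := by
      rcases lt_or_gt_of_ne hjk with h | h
      · exact (ih k hk).2.1 j h
      · exact crossCov_swap_eq_zero ((ih j hj).2.1 k h)
    have h1 (k : ℕ) (hk : k < n) : θ n (n - k) ∘L V k = crossCov (e k) (projX ν d X (n + 1)) := by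
      induction k using Nat.strong_induction_on with
      | _ k ihk =>
        have hnum : crossCov (e k) (projX ν d X (n + 1))
            = proj ν (d (n + 1)) ∘L lagCov X ((n : ℤ) - k) ∘L proj ν (d (k + 1)) -
              ∑ j ∈ Finset.range k, θ n (n - j) ∘L V j ∘L
                ContinuousLinearMap.adjoint (θ k (k - j)) := by
          rw [he, innovation, crossCov_sub_left, crossCov_projX hstat, algPredictor_eq_sum,
            crossCov_sum_left]
          congr 1
          · congr 3
            push_cast
            ring
          · refine Finset.sum_congr rfl fun j hj => ?_
            have hj' := Finset.mem_range.1 hj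
            rw [crossCov_compLp_left, ← ihk j hj' (hj'.trans hk)]
            rfl
        have hPe := proj_compLp_innovation ν d X k
        have hVP : V k ∘L proj ν (d (k + 1)) = V k := by
          rw [hVe k hk]
          conv_rhs => rw [he, ← hPe, crossCov_compLp_left, hPe, adjoint_proj]
        have hPV : proj ν (d (k + 1)) ∘L V k = V k := by
          rw [hVe k hk]
          conv_rhs => rw [he, ← hPe, crossCov_compLp_right, hPe]
        have hinv : invOn ν (d (k + 1)) (V k) ∘L V k = proj ν (d (k + 1)) := by
          refine invOn_comp_self ν hVP hPV fun x hx h => ?_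
          rw [hVe k hk] at h
          exact cov_innovation_injOn hε hX hinj k hx h
        rw [hθ, theta_rec _ _ _ hk, ← hθ, ← hnum, ContinuousLinearMap.comp_assoc, hinv]
        conv_rhs => rw [he, ← hPe, crossCov_compLp_left, adjoint_proj]
    have hpred (k : ℕ) (hk : k < n) :
        crossCov (e k) (algPredictor ν d X n) = θ n (n - k) ∘L V k := by
      rw [algPredictor_eq_sum, crossCov_sum_right, Finset.sum_eq_single_of_mem k
        (Finset.mem_range.2 hk), crossCov_compLp_right, hVe k hk]
      intro j hj hjk
      rw [crossCov_compLp_right, hun k j hk (Finset.mem_range.1 hj) hjk.symm,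
        ContinuousLinearMap.comp_zero]
    have h2 (k : ℕ) (hk : k < n) : crossCov (e k) (e n) = 0 := by
      have hen : e n = projX ν d X (n + 1) - algPredictor ν d X n := rfl
      rw [hen, crossCov_sub_right, hpred k hk, h1 k hk, sub_self]
    refine ⟨h1, h2, ?_⟩
    have h3 : crossCov (algPredictor ν d X n) (e n) = 0 := by
      rw [algPredictor_eq_sum, crossCov_sum_left]
      refine Finset.sum_eq_zero fun k hk => ?_
      rw [crossCov_compLp_left, h2 k (Finset.mem_range.1 hk), ContinuousLinearMap.zero_comp]
    have h4 : crossCov (e n) (e n) = crossCov (projX ν d X (n + 1)) (projX ν d X (n + 1))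
        - crossCov (projX ν d X (n + 1)) (algPredictor ν d X n) := by
      have h5 : crossCov (e n) (e n)
          = crossCov (projX ν d X (n + 1)) (e n) - crossCov (algPredictor ν d X n) (e n) := by
        rw [← crossCov_sub_left]
        rfl
      rw [h5, h3, sub_zero, ← crossCov_sub_right]
      rfl
    rw [h4, crossCov_projX hstat, sub_self, hV, errorCov_rec, algPredictor_eq_sum,
      crossCov_sum_right]
    congr 1
    refine Finset.sum_congr rfl fun k hk => ?_
    have hk' := Finset.mem_range.1 hk
    rw [crossCov_compLp_right, ← adjoint_crossCov, ← he, ← h1 k hk',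
      ContinuousLinearMap.adjoint_comp, hVe k hk', adjoint_crossCov, ← hVe k hk']

end Innovations

section Rate

/-! ### Tails of series -/

theorem antitone_tsum_Ici {f : ℕ → ℝ} (hf : Summable f) (h0 : ∀ k, 0 ≤ f k) :
    Antitone fun D : ℕ => ∑' k : Set.Ici D, f k := by
  intro a b hab
  simp only [tsum_Ici_eq_sub hf]
  have := Finset.sum_le_sum_of_subset_of_nonneg (Finset.range_mono hab) fun k _ _ => h0 k
  linarith

theorem Ioi_eq_Ici_succ (M : ℕ) : Set.Ioi M = Set.Ici (M + 1) := by
  ext k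
  simp

theorem hasSum_tsum_Ici {f : ℕ → ℝ} (hf : Summable f) (D : ℕ) :
    HasSum (fun j => f (j + D)) (∑' k : Set.Ici D, f k) := by
  rw [tsum_Ici_eq_sub hf]
  exact (hasSum_nat_add_iff' D).2 hf.hasSum

theorem tendsto_sub_atTop {m : ℕ → ℕ} (h : Tendsto (fun n : ℕ => (m n : ℝ) / n) atTop (𝓝 0)) :
    Tendsto (fun n => n - m n) atTop atTop := by
  refine tendsto_atTop_mono' (f₁ := fun n : ℕ => n / 2) _ ?_
    (Nat.tendsto_div_const_atTop two_ne_zero)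
  filter_upwards [h.eventually_lt_const (show (0 : ℝ) < 1 / 2 by norm_num), eventually_gt_atTop 0]
    with n hn hpos
  rw [div_lt_iff₀ (by exact_mod_cast hpos)] at hn
  have : 2 * m n < n := by
    have : (2 * m n : ℝ) < n := by linarith
    exact_mod_cast this
  omega

theorem isBigO_of_le {f g : ℕ → ℝ} {K : ℝ} (hf : ∀ n, 0 ≤ f n) (hg : ∀ n, 0 ≤ g n)
    (h : ∀ᶠ n in atTop, f n ≤ K * g n) : f =O[atTop] g :=
  IsBigO.of_bound K (h.mono fun n hn => by
    rwa [Real.norm_of_nonneg (hf n), Real.norm_of_nonneg (hg n)])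

variable {Ω : Type*} [MeasurableSpace Ω] {P : Measure Ω}
variable {H : Type*} [NormedAddCommGroup H] [InnerProductSpace ℝ H]
variable {ν : HilbertBasis ℕ ℝ H} {lam : ℕ → ℝ} {m d : ℕ → ℕ}
variable {ε X : ℤ → Lp H 2 P} {ψ π : ℕ → H →L[ℝ] H}

theorem rateBound_nonneg (hlam_pos : ∀ j, 0 < lam j) (n : ℕ) : 0 ≤ rateBound π lam m d n :=
  add_nonneg (tsum_nonneg fun _ => norm_nonneg _) (tsum_nonneg fun _ => (hlam_pos _).le)

theorem tendsto_rateBound (hπ : Summable fun j => ‖π j‖) (hlam : Summable lam)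
    (hm_top : Tendsto m atTop atTop) (hm_div : Tendsto (fun n : ℕ => (m n : ℝ) / n) atTop (𝓝 0))
    (hd_top : Tendsto d atTop atTop) : Tendsto (rateBound π lam m d) atTop (𝓝 0) := by
  have h1 : Tendsto (fun n => ∑' j : Set.Ioi (m n), ‖π j‖) atTop (𝓝 0) := by
    have h (n : ℕ) : ∑' j : Set.Ioi (m n), ‖π j‖ = ∑' j : Set.Ici (m n + 1), ‖π j‖ := by
      rw [Ioi_eq_Ici_succ]
    simp only [h]
    exact (tendsto_tsum_Ici hπ).comp ((tendsto_add_atTop_nat 1).comp hm_top)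
  have h2 : Tendsto (fun n => ∑' k : Set.Ici (d (n - m n)), lam k) atTop (𝓝 0) :=
    (tendsto_tsum_Ici hlam).comp (hd_top.comp (tendsto_sub_atTop hm_div))
  rw [← add_zero (0 : ℝ)]
  exact h1.add h2

theorem excessError_eq (pred : ℕ → Lp H 2 P) (n : ℕ) :
    excessError ε X pred n = ‖X (n + 1) - pred n - ε (n + 1)‖ ^ 2 :=
  (norm_sq_eq_integral _).symm

theorem excessError_nonneg (pred : ℕ → Lp H 2 P) (n : ℕ) : 0 ≤ excessError ε X pred n := by
  rw [excessError_eq]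
  positivity

/-! ### Approximation of the infinite past by the projected finite past -/

variable (ν d X π) in
/-- The truncated autoregression `∑_{j=1}^M π_j X_{d_{n+1-j},n+1-j}`, a predictor of `X_{n+1}`. -/
noncomputable def truncatedPredictor (M n : ℕ) : Lp H 2 P :=
  ∑ j ∈ Finset.range M, (π (j + 1)).compLp (projX ν d X (n - j))

theorem truncatedPredictor_mem_lcs {M n : ℕ} (h : M ≤ n) :
    truncatedPredictor ν d X π M n ∈ lcs (observations ν d X n) := by
  refine Submodule.sum_mem _ fun j hj => compLp_mem_lcs _ (subset_lcs _ ⟨n - j, ?_, ?_, rfl⟩)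
  · have := Finset.mem_range.1 hj
    omega
  · omega

variable [CompleteSpace H]

theorem norm_innerSL_compLp_sq_eq (hstat : IsWeaklyStationary X)
    (heig : ∀ j, lagCov X 0 (ν j) = lam j • ν j) (n : ℤ) (k : ℕ) :
    ‖(innerSL ℝ (ν k)).compLp (X n)‖ ^ 2 = lam k := by
  have h : crossCov (X n) (X n) = lagCov X 0 := by simpa [lagCov] using hstat.cov_eq n 0
  rw [← inner_cov_self, h, heig, real_inner_smul_left, real_inner_self_eq_norm_sq,
    ν.orthonormal.1 k]
  simp

theorem hasSum_eigenvalues (hstat : IsWeaklyStationary X)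
    (heig : ∀ j, lagCov X 0 (ν j) = lam j • ν j) (n : ℤ) : HasSum lam (‖X n‖ ^ 2) := by
  simpa only [norm_innerSL_compLp_sq_eq hstat heig n] using hasSum_norm_innerSL_compLp_sq ν (X n)

theorem norm_eq_norm_zero (hstat : IsWeaklyStationary X)
    (heig : ∀ j, lagCov X 0 (ν j) = lam j • ν j) (n : ℤ) : ‖X n‖ = ‖X 0‖ :=
  (pow_left_inj₀ (norm_nonneg _) (norm_nonneg _) two_ne_zero).1
    ((hasSum_eigenvalues hstat heig n).unique (hasSum_eigenvalues hstat heig 0))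

theorem norm_sub_proj_sq_eq (hstat : IsWeaklyStationary X)
    (heig : ∀ j, lagCov X 0 (ν j) = lam j • ν j) (n : ℤ) (D : ℕ) :
    ‖X n - (proj ν D).compLp (X n)‖ ^ 2 = ∑' k : Set.Ici D, lam k := by
  rw [norm_sub_proj_sq]
  exact tsum_congr fun k => norm_innerSL_compLp_sq_eq hstat heig n k

/-- The first term bounds the part of the autoregression before the truncation, the second one the
effect of the projections, all of which are on spaces of dimension at least `d_{n-M}`. -/
theorem norm_sub_truncatedPredictor_le (hstat : IsWeaklyStationary X)
    (hinv : IsInverseRepresentation π ε X) (heig : ∀ j, lagCov X 0 (ν j) = lam j • ν j)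
    (hlam_pos : ∀ j, 0 < lam j) (hd_mono : Monotone d) {M n : ℕ} (h : M < n) :
    ‖X (n + 1) - ε (n + 1) - truncatedPredictor ν d X π M n‖
      ≤ ‖X 0‖ * ∑' j : Set.Ioi M, ‖π j‖
        + (∑' j, ‖π j‖) * √(∑' k : Set.Ici (d (n - M)), lam k) := by
  have hπ := summable_norm_coeff hinv
  have hlam := (hasSum_eigenvalues hstat heig 0).summable
  set L := ∑' k : Set.Ici (d (n - M)), lam k with hL
  have hs := (hasSum_nat_add_iff' M).2 (hinv.hasSum (n + 1))
  set A := ∑ j ∈ Finset.range M, (π (j + 1)).compLp (X ((n + 1 : ℤ) - (j + 1 : ℕ))) with hA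
  have h1 : ‖X (n + 1) - ε (n + 1) - A‖ ≤ ‖X 0‖ * ∑' j : Set.Ioi M, ‖π j‖ := by
    rw [Ioi_eq_Ici_succ]
    refine hs.norm_le_of_bounded ((hasSum_tsum_Ici hπ (M + 1)).mul_left ‖X 0‖) fun j => ?_
    refine (ContinuousLinearMap.norm_compLp_le _ _).trans_eq ?_
    rw [norm_eq_norm_zero hstat heig, mul_comm]
    rfl
  have h2 : ‖A - truncatedPredictor ν d X π M n‖ ≤ (∑' j, ‖π j‖) * √L := by
    rw [hA, truncatedPredictor, ← Finset.sum_sub_distrib]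
    have hj (j : ℕ) (hj : j ∈ Finset.range M) :
        ‖(π (j + 1)).compLp (X ((n + 1 : ℤ) - (j + 1 : ℕ)))
            - (π (j + 1)).compLp (projX ν d X (n - j))‖
          ≤ ‖π (j + 1)‖ * √L := by
      have hj' := Finset.mem_range.1 hj
      rw [← compLp_sub_right]
      refine (ContinuousLinearMap.norm_compLp_le _ _).trans
        (mul_le_mul_of_nonneg_left ?_ (norm_nonneg _))
      have hidx : ((n + 1 : ℤ) - (j + 1 : ℕ)) = ((n - j : ℕ) : ℤ) := by
        push_cast [Nat.cast_sub (hj'.trans h).le]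
        ring
      rw [hidx, projX]
      refine Real.le_sqrt_of_sq_le ?_
      rw [norm_sub_proj_sq_eq hstat heig]
      exact antitone_tsum_Ici hlam (fun k => (hlam_pos k).le) (hd_mono (by omega))
    refine (norm_sum_le_of_le _ hj).trans ?_
    rw [← Finset.sum_mul]
    refine mul_le_mul_of_nonneg_right ?_ (Real.sqrt_nonneg _)
    refine le_trans ?_ (hπ.sum_le_tsum (Finset.range (M + 1)) fun _ _ => norm_nonneg _)
    rw [Finset.sum_range_succ']
    exact le_add_of_nonneg_right (norm_nonneg _)
  calc ‖X (n + 1) - ε (n + 1) - truncatedPredictor ν d X π M n‖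
      = ‖(X (n + 1) - ε (n + 1) - A) + (A - truncatedPredictor ν d X π M n)‖ := by congr 1; abel
    _ ≤ _ := (norm_add_le _ _).trans (add_le_add h1 h2)

/-! ### Rates of convergence of the predictors -/

theorem exists_norm_sub_truncatedPredictor_sq_le (hstat : IsWeaklyStationary X)
    (hinv : IsInverseRepresentation π ε X) (heig : ∀ j, lagCov X 0 (ν j) = lam j • ν j)
    (hlam_pos : ∀ j, 0 < lam j) (hd_mono : Monotone d) : ∃ K, 0 ≤ K ∧ ∀ n, m n < n →
      ‖X (n + 1) - ε (n + 1) - truncatedPredictor ν d X π (m n) n‖ ^ 2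
        ≤ K * rateBound π lam m d n := by
  have hπ := summable_norm_coeff hinv
  set S := ∑' j, ‖π j‖ with hS
  have hS0 : 0 ≤ S := tsum_nonneg fun _ => norm_nonneg _
  refine ⟨2 * (‖X 0‖ ^ 2 * S + S ^ 2), by positivity, fun n hn => ?_⟩
  have h := norm_sub_truncatedPredictor_le hstat hinv heig hlam_pos hd_mono hn
  rw [rateBound]
  set T := ∑' j : Set.Ioi (m n), ‖π j‖ with hT
  set L := ∑' k : Set.Ici (d (n - m n)), lam k with hL
  have hT0 : 0 ≤ T := tsum_nonneg fun _ => norm_nonneg _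
  have hL0 : 0 ≤ L := tsum_nonneg fun _ => (hlam_pos _).le
  have hTS : T ≤ S := Summable.tsum_subtype_le _ (Set.Ioi (m n)) (fun _ => norm_nonneg _) hπ
  calc _ ≤ (‖X 0‖ * T + S * √L) ^ 2 := pow_le_pow_left₀ (norm_nonneg _) h 2
    _ ≤ 2 * ((‖X 0‖ * T) ^ 2 + (S * √L) ^ 2) := add_sq_le
    _ = 2 * (‖X 0‖ ^ 2 * (T * T) + S ^ 2 * L) := by rw [mul_pow S, Real.sq_sqrt hL0]; ring
    _ ≤ 2 * (‖X 0‖ ^ 2 * (S * T) + S ^ 2 * L) := by gcongr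
    _ ≤ 2 * (‖X 0‖ ^ 2 * S + S ^ 2) * (T + L) := by
      have h1 : 0 ≤ ‖X 0‖ ^ 2 * S * L := by positivity
      have h2 : 0 ≤ S ^ 2 * T := by positivity
      nlinarith

/-- Since `ε_{n+1}` is orthogonal to the past, the excess error of the best predictor is the squared
distance of `X_{n+1} - ε_{n+1}` to the space spanned by the projected past. -/
theorem norm_sub_bestPredictor_le (hε : IsWhiteNoise ε) (hX : IsLinearProcess ψ ε X) {n : ℕ}
    {W : Lp H 2 P} (hW : W ∈ lcs (observations ν d X n)) :
    ‖X (n + 1) - bestPredictor ν d X n - ε (n + 1)‖ ≤ ‖X (n + 1) - ε (n + 1) - W‖ := by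
  set G := lcs (observations ν d X n) with hG
  have h0 : G.starProjection (ε (n + 1)) = 0 := by
    refine (Submodule.starProjection_apply_eq_zero_iff _).2 ((Submodule.mem_orthogonal' _ _).2
      fun Y hY => inner_eq_zero_of_crossCov_eq_zero ν ?_)
    exact lcs_observations_le hε hX n hY
  have h1 : X (n + 1) - bestPredictor ν d X n - ε (n + 1)
      = (X (n + 1) - ε (n + 1)) - G.starProjection (X (n + 1) - ε (n + 1)) := by
    rw [map_sub, h0, sub_zero, bestPredictor]
    exact sub_right_comm _ _ _
  rw [h1, Submodule.starProjection_minimal]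
  exact ciInf_le ⟨0, by rintro _ ⟨w, rfl⟩; exact norm_nonneg _⟩ (⟨W, hW⟩ : G)

/-- Each innovation is uncorrelated with the projected past. -/
theorem lcs_observations_le_innovation (hε : IsWhiteNoise ε) (hX : IsLinearProcess ψ ε X)
    (hstat : IsWeaklyStationary X) (hinj : ∀ x, crossCov (ε 0) (ε 0) x = 0 → x = 0) (n : ℕ) :
    lcs (observations ν d X n) ≤ uncorrelatedWith (innovation ν d X n) := by
  refine lcs_le_uncorrelatedWith ?_
  rintro _ ⟨k, hk1, hk, rfl⟩
  obtain ⟨k, rfl⟩ := Nat.exists_eq_add_of_le' hk1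
  have h1 : projX ν d X (k + 1) = innovation ν d X k + algPredictor ν d X k :=
    (sub_add_cancel _ _).symm
  have h2 (j : ℕ) (hj : j < n) : crossCov (innovation ν d X n) (innovation ν d X j) = 0 :=
    crossCov_swap_eq_zero ((innovations_algorithm hε hX hstat hinj n).2.1 j hj)
  rw [h1, crossCov_add_right, h2 k hk, algPredictor_eq_sum, crossCov_sum_right, zero_add]
  refine Finset.sum_eq_zero fun j hj => ?_
  have := Finset.mem_range.1 hj
  rw [crossCov_compLp_right, h2 j (by omega), ContinuousLinearMap.comp_zero]

/-- The output of the innovations algorithm is the orthogonal projection of `X_{d_{n+1},n+1}` on the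
space spanned by the projected past. -/
theorem algPredictor_eq_starProjection (hε : IsWhiteNoise ε) (hX : IsLinearProcess ψ ε X)
    (hstat : IsWeaklyStationary X) (hinj : ∀ x, crossCov (ε 0) (ε 0) x = 0 → x = 0) (n : ℕ) :
    algPredictor ν d X n
      = (lcs (observations ν d X n)).starProjection (projX ν d X (n + 1)) :=
  (Submodule.eq_starProjection_of_mem_of_inner_eq_zero (algPredictor_mem_lcs ν d X n)
    fun _ hW => inner_eq_zero_of_crossCov_eq_zero ν
      (lcs_observations_le_innovation hε hX hstat hinj n hW)).symm

theorem exists_error_bounds (hε : IsWhiteNoise ε) (hX : IsLinearProcess ψ ε X)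
    (hstat : IsWeaklyStationary X) (hinv : IsInverseRepresentation π ε X)
    (hinj : ∀ x, crossCov (ε 0) (ε 0) x = 0 → x = 0)
    (heig : ∀ j, lagCov X 0 (ν j) = lam j • ν j) (hlam_pos : ∀ j, 0 < lam j)
    (hd_mono : Monotone d) : ∃ K, 0 ≤ K ∧ ∀ n, m n < n →
      excessError ε X (bestPredictor ν d X) n ≤ K * rateBound π lam m d n ∧
      excessError ε X (algPredictor ν d X) n ≤ K * rateBound π lam m d n ∧
      ‖algPredictor ν d X n - truncatedPredictor ν d X π (m n) n‖ ^ 2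
        ≤ K * rateBound π lam m d n := by
  obtain ⟨K, hK0, hK⟩ :=
    exists_norm_sub_truncatedPredictor_sq_le (m := m) hstat hinv heig hlam_pos hd_mono
  have hlam := (hasSum_eigenvalues hstat heig 0).summable
  refine ⟨6 * K + 4, by positivity, fun n hn => ?_⟩
  rw [excessError_eq, excessError_eq]
  specialize hK n hn
  set R := rateBound π lam m d n with hR
  have hR0 : 0 ≤ R := rateBound_nonneg hlam_pos n
  set W := truncatedPredictor ν d X π (m n) n with hW
  have hKR : 0 ≤ K * R := by positivity
  have h1 : ‖X (n + 1) - bestPredictor ν d X n - ε (n + 1)‖ ^ 2 ≤ K * R :=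
    (pow_le_pow_left₀ (norm_nonneg _) (norm_sub_bestPredictor_le hε hX
      (truncatedPredictor_mem_lcs hn.le)) 2).trans hK
  have h2 : ‖bestPredictor ν d X n - algPredictor ν d X n‖ ^ 2 ≤ R := by
    have h3 : bestPredictor ν d X n - algPredictor ν d X n
        = (lcs (observations ν d X n)).starProjection
          (X (n + 1) - (proj ν (d (n + 1))).compLp (X (n + 1))) := by
      rw [algPredictor_eq_starProjection hε hX hstat hinj, map_sub]
      rfl
    rw [h3]
    refine (pow_le_pow_left₀ (norm_nonneg _)
      (Submodule.norm_starProjection_apply_le _ _) 2).trans ?_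
    rw [norm_sub_proj_sq_eq hstat heig]
    refine (antitone_tsum_Ici hlam (fun k => (hlam_pos k).le)
      (hd_mono (show n - m n ≤ n + 1 by omega))).trans ?_
    exact le_add_of_nonneg_left (tsum_nonneg fun _ => norm_nonneg _)
  have hsq (a b c : Lp H 2 P) (hc : c = a + b) : ‖c‖ ^ 2 ≤ 2 * (‖a‖ ^ 2 + ‖b‖ ^ 2) := by
    rw [hc]
    exact (pow_le_pow_left₀ (norm_nonneg _) (norm_add_le _ _) 2).trans add_sq_le
  have h4 := hsq (X (n + 1) - bestPredictor ν d X n - ε (n + 1))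
    (bestPredictor ν d X n - algPredictor ν d X n) (X (n + 1) - algPredictor ν d X n - ε (n + 1))
    (by abel)
  have h5 := hsq (X (n + 1) - ε (n + 1) - W) (-(X (n + 1) - algPredictor ν d X n - ε (n + 1)))
    (algPredictor ν d X n - W) (by abel)
  rw [norm_neg] at h5
  refine ⟨by nlinarith, by nlinarith, by nlinarith⟩

end Rate

section Transfer

/-! ### Double series -/

theorem hasSum_inner_prod {E : Type*} [NormedAddCommGroup E] [InnerProductSpace ℂ E] {u v : ℕ → E}
    {U V : E} (hu : Summable fun j => ‖u j‖) (hv : Summable fun j => ‖v j‖) (hU : HasSum u U)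
    (hV : HasSum v V) :
    HasSum (fun p : ℕ × ℕ => inner ℂ (u p.1) (v p.2)) (inner ℂ U V) := by
  have hs : Summable fun p : ℕ × ℕ => inner ℂ (u p.1) (v p.2) := by
    refine Summable.of_norm_bounded (hu.mul_of_nonneg hv (fun _ => norm_nonneg _)
      fun _ => norm_nonneg _) fun p => norm_inner_le_norm _ _
  have h1 : HasSum (fun l => inner ℂ (u l) V) (∑' p : ℕ × ℕ, inner ℂ (u p.1) (v p.2)) :=
    hs.hasSum.prod_fiberwise fun l => (innerSL ℂ (u l)).hasSum hV
  have h2 : HasSum (fun l => inner ℂ (u l) V) (inner ℂ U V) := (innerSLFlip ℂ V).hasSum hU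
  rw [← h1.unique h2]
  exact hs.hasSum

variable {H : Type*} [NormedAddCommGroup H] [InnerProductSpace ℝ H]

/-- The complex exponential `e^{-ihω}`. -/
noncomputable def expNeg (ω : ℝ) (h : ℤ) : ℂ := Complex.exp (-Complex.I * h * ω)

theorem expNeg_zero (ω : ℝ) : expNeg ω 0 = 1 := by simp [expNeg]

theorem expNeg_add (ω : ℝ) (a b : ℤ) : expNeg ω (a + b) = expNeg ω a * expNeg ω b := by
  rw [expNeg, expNeg, expNeg, ← Complex.exp_add]
  congr 1
  push_cast
  ring

theorem norm_expNeg (ω : ℝ) (h : ℤ) : ‖expNeg ω h‖ = 1 := by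
  have : expNeg ω h = Complex.exp ((-h * ω : ℝ) * Complex.I) := by
    rw [expNeg]
    congr 1
    push_cast
    ring
  rw [this, Complex.norm_exp_ofReal_mul_I]

theorem star_expNeg (ω : ℝ) (h : ℤ) : (starRingEnd ℂ) (expNeg ω h) = expNeg ω (-h) := by
  rw [expNeg, expNeg, ← Complex.exp_conj]
  congr 1
  simp

/-! ### Transfer functions -/

/-- The transfer function `∑_j e^{-ijω} a_j` of the filter with coefficients `a`, acting from the
right on complex-valued bounded linear functionals. The complex Banach space of these functionals
plays the role of a complexification of the dual of `H`. -/
noncomputable def transfer (a : ℕ → H →L[ℝ] H) (ω : ℝ) (φ : H →L[ℝ] ℂ) : H →L[ℝ] ℂ :=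
  ∑' j : ℕ, expNeg ω j • (φ ∘L a j)

theorem summable_norm_transfer {a : ℕ → H →L[ℝ] H} (ha : Summable fun j => ‖a j‖) (ω : ℝ)
    (φ : H →L[ℝ] ℂ) : Summable fun j : ℕ => ‖expNeg ω j • (φ ∘L a j)‖ := by
  refine Summable.of_nonneg_of_le (fun _ => norm_nonneg _) (fun j => ?_) (ha.mul_left ‖φ‖)
  rw [norm_smul, norm_expNeg, one_mul]
  exact ContinuousLinearMap.opNorm_comp_le _ _

theorem hasSum_transfer {a : ℕ → H →L[ℝ] H} (ha : Summable fun j => ‖a j‖) (ω : ℝ)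
    (φ : H →L[ℝ] ℂ) : HasSum (fun j : ℕ => expNeg ω j • (φ ∘L a j)) (transfer a ω φ) :=
  (summable_norm_transfer ha ω φ).of_norm.hasSum

/-- If `b` is a right inverse of `a` for the convolution product, then the transfer function of `b`
undoes that of `a`. -/
theorem transfer_transfer {a b : ℕ → H →L[ℝ] H} (ha : Summable fun j => ‖a j‖)
    (hb : Summable fun j => ‖b j‖)
    (hab : ∀ n : ℕ, ∑ p ∈ Finset.HasAntidiagonal.antidiagonal n, a p.1 * b p.2
      = if n = 0 then 1 else 0) (ω : ℝ) (φ : H →L[ℝ] ℂ) :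
    transfer b ω (transfer a ω φ) = φ := by
  set F : ℕ × ℕ → H →L[ℝ] ℂ := fun p => expNeg ω (p.1 + p.2 : ℕ) • (φ ∘L (a p.1 * b p.2)) with hF
  have hs : Summable F := by
    refine Summable.of_norm_bounded ((ha.mul_of_nonneg hb (fun _ => norm_nonneg _)
      fun _ => norm_nonneg _).mul_left ‖φ‖) fun p => ?_
    rw [hF, norm_smul, norm_expNeg, one_mul]
    exact (ContinuousLinearMap.opNorm_comp_le _ _).trans
      (mul_le_mul_of_nonneg_left (norm_mul_le _ _) (norm_nonneg _))
  have h1 : HasSum (fun l : ℕ => expNeg ω l • (transfer a ω φ ∘L b l)) (∑' p, F p) := by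
    have hswap := (Equiv.prodComm ℕ ℕ).hasSum_iff.2 hs.hasSum
    refine hswap.prod_fiberwise fun l => ?_
    have h2 : HasSum (fun j : ℕ => (expNeg ω j • (φ ∘L a j)) ∘L b l) (transfer a ω φ ∘L b l) :=
      ((ContinuousLinearMap.compL ℝ H H ℂ).flip (b l)).hasSum (hasSum_transfer ha ω φ)
    refine (h2.const_smul (expNeg ω l)).congr_fun fun j => ?_
    change F (j, l) = _
    rw [hF, ContinuousLinearMap.smul_comp, smul_smul, ← expNeg_add, add_comm (l : ℤ)]
    push_cast
    rfl
  have h3 : HasSum (fun n : ℕ => if n = 0 then φ else 0) (∑' p, F p) := by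
    have hsig := Finset.HasAntidiagonal.sigmaAntidiagonalEquivProd.hasSum_iff.2 hs.hasSum
    refine (hsig.sigma fun n => hasSum_fintype _).congr_fun fun n => ?_
    have h4 (p : Finset.HasAntidiagonal.antidiagonal n) :
        F p = expNeg ω n • (ContinuousLinearMap.compL ℝ H H ℂ φ) (a p.1.1 * b p.1.2) := by
      have h5 : p.1.1 + p.1.2 = n := Finset.HasAntidiagonal.mem_antidiagonal.1 p.2
      simp only [hF, h5]
      rfl
    change _ = ∑ p : Finset.HasAntidiagonal.antidiagonal n, F p
    rw [Finset.sum_congr rfl fun p _ => h4 p, ← Finset.smul_sum, ← map_sum,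
      Finset.sum_coe_sort (Finset.HasAntidiagonal.antidiagonal n) fun p => a p.1 * b p.2, hab]
    by_cases hn : n = 0
    · subst hn
      simp [expNeg_zero, ContinuousLinearMap.one_def]
    · simp [hn]
  rw [transfer, h1.tsum_eq, ← h3.tsum_eq, tsum_ite_eq]

theorem transfer_injective {a b : ℕ → H →L[ℝ] H} (ha : Summable fun j => ‖a j‖)
    (hb : Summable fun j => ‖b j‖)
    (hab : ∀ n : ℕ, ∑ p ∈ Finset.HasAntidiagonal.antidiagonal n, a p.1 * b p.2
      = if n = 0 then 1 else 0) (ω : ℝ) :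
    Function.Injective (transfer a ω) :=
  Function.LeftInverse.injective (transfer_transfer ha hb hab ω)

variable {Ω : Type*} [MeasurableSpace Ω] {P : Measure Ω}

theorem inner_compLp_eq [CompleteSpace H] (χ φ : H →L[ℝ] ℂ) (Y Z : Lp H 2 P) :
    inner ℂ (χ.compLp Y) (φ.compLp Z)
      = φ (crossCov Y Z ((InnerProductSpace.toDual ℝ H).symm (Complex.reCLM ∘L χ)))
        - Complex.I *
          φ (crossCov Y Z ((InnerProductSpace.toDual ℝ H).symm (Complex.imCLM ∘L χ))) := by
  have h1 (x : H) : φ (crossCov Y Z x) = ∫ ω, inner ℝ (Y ω) x • φ (Z ω) ∂P := by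
    rw [crossCov_apply, ← φ.integral_comp_comm (integrable_inner_smul Y Z x)]
    simp
  have h2 (x : H) : Integrable (fun ω => inner ℝ (Y ω) x • φ (Z ω)) P := by
    simpa using φ.integrable_comp (integrable_inner_smul Y Z x)
  rw [h1, h1, ← integral_const_mul, ← integral_sub (h2 _) ((h2 _).const_mul _), L2.inner_def]
  refine integral_congr_ae ?_
  filter_upwards [χ.coeFn_compLp Y, φ.coeFn_compLp Z] with ω h3 h4
  rw [h3, h4, real_inner_comm, real_inner_comm _ (Y ω), InnerProductSpace.toDual_symm_apply,
    InnerProductSpace.toDual_symm_apply]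
  have h5 : (starRingEnd ℂ) (χ (Y ω)) = (χ (Y ω)).re - Complex.I * (χ (Y ω)).im := by
    apply Complex.ext <;> simp
  simp only [RCLike.inner_apply, h5, ContinuousLinearMap.comp_apply, Complex.reCLM_apply,
    Complex.imCLM_apply, Complex.real_smul]
  ring

/-- The complex covariances of functionals of `Y` and `Z` only depend on the cross covariance
operator. -/
theorem inner_compLp_congr [CompleteSpace H] (χ φ : H →L[ℝ] ℂ) {Y Z Y' Z' : Lp H 2 P}
    (h : crossCov Y Z = crossCov Y' Z') :
    inner ℂ (χ.compLp Y) (φ.compLp Z) = inner ℂ (χ.compLp Y') (φ.compLp Z') := by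
  rw [inner_compLp_eq, inner_compLp_eq, h]

end Transfer

section Spectral

open scoped ComplexOrder

variable {Ω : Type*} [MeasurableSpace Ω] {P : Measure Ω}
variable {H : Type*} [NormedAddCommGroup H] [InnerProductSpace ℝ H]
variable {ε X : ℤ → Lp H 2 P} {ψ π : ℕ → H →L[ℝ] H}

/-! ### Coordinate functionals -/

variable (ν : HilbertBasis ℕ ℝ H)

/-- The coordinate functional `⟨ν_k, ·⟩` with values in the complex numbers. -/
noncomputable def coordFunctional (k : ℕ) : H →L[ℝ] ℂ := Complex.ofRealCLM ∘L innerSL ℝ (ν k)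

theorem inner_coordFunctional (X : ℤ → Lp H 2 P) {D : ℕ} (h : ℤ)
    (k l : Fin D) :
    inner ℂ ((coordFunctional ν l).compLp (X 0)) ((coordFunctional ν k).compLp (X h))
      = (covMatrix ν X D h k l : ℂ) := by
  rw [L2.inner_def, covMatrix, Matrix.of_apply, ← integral_complex_ofReal]
  refine integral_congr_ae ?_
  filter_upwards [(coordFunctional ν l).coeFn_compLp (X 0),
    (coordFunctional ν k).coeFn_compLp (X h)] with ω h1 h2
  rw [h1, h2]
  simp [coordFunctional, real_inner_comm]

theorem linearIndependent_coordFunctional (D : ℕ) :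
    LinearIndependent ℂ fun k : Fin D => coordFunctional ν k := by
  rw [Fintype.linearIndependent_iff]
  intro g hg k
  have h := DFunLike.congr_fun hg (ν k)
  rw [_root_.sum_apply, Finset.sum_eq_single k] at h
  · simpa [coordFunctional, ν.orthonormal.1 k] using h
  · intro j _ hj
    have : inner ℝ (ν j) (ν k) = (0 : ℝ) := ν.orthonormal.2 fun h => hj (Fin.ext h)
    simp [coordFunctional, this]
  · simp

variable [CompleteSpace H]

/-! ### The spectral density as a Gram matrix -/

/-- The covariance of `χ(X_0)` and `φ(X_h)` is the sum over the pairs of moving average indices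
`(l, j)` that refer to the same time, i.e. with `j - l = h`. -/
theorem hasSum_inner_process (hε : IsWhiteNoise ε) (hX : IsLinearProcess ψ ε X)
    (χ φ : H →L[ℝ] ℂ) (h : ℤ) :
    HasSum (fun j : ℕ => if h ≤ j then
        inner ℂ ((χ ∘L ψ (j - h).toNat).compLp (ε 0)) ((φ ∘L ψ j).compLp (ε 0)) else 0)
      (inner ℂ (χ.compLp (X 0)) (φ.compLp (X h))) := by
  have h1 : HasSum (fun j : ℕ => inner ℂ (χ.compLp (X 0)) (φ.compLp ((ψ j).compLp (ε (h - j)))))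
      (inner ℂ (χ.compLp (X 0)) (φ.compLp (X h))) :=
    (innerSL ℂ (χ.compLp (X 0))).hasSum (compLp_hasSum φ (hX.hasSum h))
  refine h1.congr_fun fun j => ?_
  rw [← comp_compLp]
  split_ifs with hj
  · obtain ⟨l, hl⟩ := Int.eq_ofNat_of_zero_le (sub_nonneg.2 hj)
    have h2 : crossCov (ε (h - j)) (X 0) = ψ l ∘L crossCov (ε 0) (ε 0) := by
      rw [← crossCov_noise_future hε hX (h - j) l]
      congr 2
      omega
    rw [hl, Int.toNat_natCast, comp_compLp χ]
    refine inner_compLp_congr χ _ ?_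
    rw [crossCov_compLp_left, ← adjoint_crossCov (ε (h - j)), h2, ContinuousLinearMap.adjoint_comp,
      adjoint_crossCov]
  · have h2 : crossCov (X 0) (ε (h - j)) = crossCov (X 0) 0 := by
      rw [crossCov_swap_eq_zero (crossCov_noise_past hε hX (by omega))]
      exact (map_zero (crossCovL (X 0))).symm
    rw [inner_compLp_congr χ (φ ∘L ψ j) h2]
    have : (φ ∘L ψ j).compLp (0 : Lp H 2 P) = 0 := map_zero ((φ ∘L ψ j).compLpL 2 P)
    rw [this, inner_zero_right]

/-- The cross spectral density of the complex processes `χ(X_n)` and `φ(X_n)` (up to the factor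
`2π`) is the inner product of the transformed functionals of the noise. -/
theorem hasSum_expNeg_mul_inner (hε : IsWhiteNoise ε) (hX : IsLinearProcess ψ ε X)
    (hψ : Summable fun j => ‖ψ j‖) (χ φ : H →L[ℝ] ℂ) (ω : ℝ) :
    HasSum (fun h : ℤ => expNeg ω h * inner ℂ (χ.compLp (X 0)) (φ.compLp (X h)))
      (inner ℂ ((transfer ψ ω χ).compLp (ε 0)) ((transfer ψ ω φ).compLp (ε 0))) := by
  have hsum (φ : H →L[ℝ] ℂ) : Summable fun j : ℕ =>
      ‖(expNeg ω j • (φ ∘L ψ j)).compLp (ε 0)‖ :=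
    Summable.of_nonneg_of_le (fun _ => norm_nonneg _)
      (fun j => ContinuousLinearMap.norm_compLp_le _ _)
      ((summable_norm_transfer hψ ω φ).mul_right ‖ε 0‖)
  have hhas (φ : H →L[ℝ] ℂ) : HasSum (fun j : ℕ => (expNeg ω j • (φ ∘L ψ j)).compLp (ε 0))
      ((transfer ψ ω φ).compLp (ε 0)) := (evalOn (ε 0)).hasSum (hasSum_transfer hψ ω φ)
  have h1 := hasSum_inner_prod (hsum χ) (hsum φ) (hhas χ) (hhas φ)
  -- the pair `(l, j)` of moving average indices contributes to the lag `j - l`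
  set i : ℕ × ℕ → ℤ × ℕ := fun p => ((p.2 : ℤ) - p.1, p.2) with hi
  have hinj : Function.Injective i := by
    rintro ⟨a, b⟩ ⟨a', b'⟩ h
    simp only [hi, Prod.mk.injEq] at h
    ext <;> simp <;> omega
  set g : ℤ × ℕ → ℂ := fun q => expNeg ω q.1 * if q.1 ≤ q.2 then
    inner ℂ ((χ ∘L ψ (q.2 - q.1).toNat).compLp (ε 0)) ((φ ∘L ψ q.2).compLp (ε 0)) else 0 with hg
  have h2 : HasSum (g ∘ i)
      (inner ℂ ((transfer ψ ω χ).compLp (ε 0)) ((transfer ψ ω φ).compLp (ε 0))) := by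
    refine h1.congr_fun fun p => ?_
    have h3 : (p.2 - (p.2 - p.1) : ℤ).toNat = p.1 := by omega
    have h4 : (p.2 - p.1 : ℤ) ≤ p.2 := by omega
    simp only [Function.comp_apply, hg, hi, h3, if_pos h4, ContinuousLinearMap.smul_compLp,
      inner_smul_left, inner_smul_right, star_expNeg]
    rw [sub_eq_add_neg, expNeg_add]
    ring
  rw [hinj.hasSum_iff] at h2
  · exact h2.prod_fiberwise fun h => (hasSum_inner_process hε hX χ φ h).mul_left (expNeg ω h)
  · rintro ⟨h, j⟩ hq
    have : ¬ h ≤ j := fun hle => hq ⟨((j - h).toNat, j), by simp [hi]; omega⟩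
    simp [hg, this]

/-- The Gram matrix of the transformed coordinate functionals of the noise, transposed; `2π` times
the spectral density matrix. -/
noncomputable def noiseGram (ψ : ℕ → H →L[ℝ] H) (ε : ℤ → Lp H 2 P) (D : ℕ) (ω : ℝ) :
    Matrix (Fin D) (Fin D) ℂ :=
  (Matrix.gram ℂ fun k : Fin D => (transfer ψ ω (coordFunctional ν k)).compLp (ε 0)).transpose

theorem hasSum_spectralTerm (hε : IsWhiteNoise ε) (hX : IsLinearProcess ψ ε X)
    (hψ : Summable fun j => ‖ψ j‖) (D : ℕ) (ω : ℝ) :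
    HasSum (spectralTerm ν X D ω) (noiseGram ν ψ ε D ω) := by
  refine Pi.hasSum.2 fun k => Pi.hasSum.2 fun l => ?_
  have := hasSum_expNeg_mul_inner hε hX hψ (coordFunctional ν l) (coordFunctional ν k) ω
  simp only [inner_coordFunctional] at this
  exact this

theorem spectralDensity_eq (hε : IsWhiteNoise ε) (hX : IsLinearProcess ψ ε X)
    (hψ : Summable fun j => ‖ψ j‖) (D : ℕ) (ω : ℝ) :
    spectralDensity ν X D ω = (1 / (2 * Real.pi) : ℂ) • noiseGram ν ψ ε D ω := by
  rw [spectralDensity, (hasSum_spectralTerm ν hε hX hψ D ω).tsum_eq]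

theorem compLp_noise_injective (hinj : ∀ x, crossCov (ε 0) (ε 0) x = 0 → x = 0) {φ : H →L[ℝ] ℂ}
    (h : φ.compLp (ε 0) = 0) : φ = 0 := by
  have key (L : ℂ →L[ℝ] ℝ) : L ∘L φ = 0 := by
    obtain ⟨a, ha⟩ := (InnerProductSpace.toDual ℝ H).surjective (L ∘L φ)
    have h1 : (innerSL ℝ a).compLp (ε 0) = 0 := by
      have h2 : innerSL ℝ a = L ∘L φ := ha
      rw [h2, comp_compLp, h]
      exact map_zero (L.compLpL 2 P)
    rw [← ha, hinj a (cov_apply_eq_zero h1), map_zero]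
  ext x
  apply Complex.ext
  · exact DFunLike.congr_fun (key Complex.reCLM) x
  · exact DFunLike.congr_fun (key Complex.imCLM) x

/-- The spectral density matrix is positive definite: the coordinate functionals are linearly
independent, the transfer function has a left inverse (invertibility of the process), and the noise
annihilates no functional. -/
theorem posDef_spectralDensity (ν : HilbertBasis ℕ ℝ H) (hε : IsWhiteNoise ε)
    (hX : IsLinearProcess ψ ε X) (hinv : IsInverseRepresentation π ε X)
    (hinj : ∀ x, crossCov (ε 0) (ε 0) x = 0 → x = 0)
    (hψ : Summable fun j => ‖ψ j‖) (D : ℕ) (ω : ℝ) : (spectralDensity ν X D ω).PosDef := by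
  have hπ := summable_norm_arCoeff (summable_norm_coeff hinv)
  have hT := transfer_injective hψ hπ (sum_coeff_mul_arCoeff hX.coeff_zero
    fun n hn => coeff_recursion hε hX hinv hinj hn) ω
  let T : (H →L[ℝ] ℂ) →ₗ[ℂ] Lp ℂ 2 P :=
    { toFun := fun φ => (transfer ψ ω φ).compLp (ε 0)
      map_add' := fun φ χ => by
        have : transfer ψ ω (φ + χ) = transfer ψ ω φ + transfer ψ ω χ := by
          refine (hasSum_transfer hψ ω _).unique ?_
          refine ((hasSum_transfer hψ ω φ).add (hasSum_transfer hψ ω χ)).congr_fun fun j => ?_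
          rw [ContinuousLinearMap.add_comp, smul_add]
        rw [this, ContinuousLinearMap.add_compLp]
      map_smul' := fun c φ => by
        have : transfer ψ ω (c • φ) = c • transfer ψ ω φ := by
          refine (hasSum_transfer hψ ω _).unique ?_
          refine ((hasSum_transfer hψ ω φ).const_smul c).congr_fun fun j => ?_
          rw [ContinuousLinearMap.smul_comp, smul_comm]
        rw [this, ContinuousLinearMap.smul_compLp]
        rfl }
  have hker : LinearMap.ker T = ⊥ := by
    refine LinearMap.ker_eq_bot'.2 fun φ hφ => hT ?_
    have h0 : transfer ψ ω (0 : H →L[ℝ] ℂ) = 0 := by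
      refine (hasSum_transfer hψ ω 0).unique (hasSum_zero.congr_fun fun j => ?_)
      rw [ContinuousLinearMap.zero_comp]
      exact smul_zero (A := H →L[ℝ] ℂ) (expNeg ω j)
    rw [h0]
    exact compLp_noise_injective hinj hφ
  have hli := (linearIndependent_coordFunctional ν D).map' T hker
  have hG := (Matrix.posDef_gram_of_linearIndependent hli).transpose
  rw [spectralDensity_eq ν hε hX hψ]
  have hpos : (0 : ℂ) < 1 / (2 * Real.pi) := by
    have : (0 : ℝ) < 1 / (2 * Real.pi) := by positivity
    exact_mod_cast this
  exact hG.smul hpos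

end Spectral

section Alpha

open scoped ComplexOrder Matrix

/-! ### Eigenvalues of Hermitian matrices -/

theorem exists_pos_of_hasEigenvalue {D : ℕ} {A : Matrix (Fin D) (Fin D) ℂ} (hA : A.PosDef) {z : ℂ}
    (hz : Module.End.HasEigenvalue (Matrix.toLin' A) z) : ∃ a : ℝ, 0 < a ∧ z = a := by
  obtain ⟨v, hv⟩ := hz.exists_hasEigenvector
  have h1 : A *ᵥ v = z • v := by simpa using hv.apply_eq_smul
  have h2 := hA.dotProduct_mulVec_pos hv.2
  have h3 : 0 < star v ⬝ᵥ v := Matrix.dotProduct_star_self_pos_iff.2 hv.2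
  rw [h1, dotProduct_smul, smul_eq_mul] at h2
  obtain ⟨t, ht, hts⟩ := (RCLike.pos_iff_exists_ofReal (K := ℂ)).1 h2
  obtain ⟨r, hr, hrs⟩ := (RCLike.pos_iff_exists_ofReal (K := ℂ)).1 h3
  refine ⟨t / r, div_pos ht hr, ?_⟩
  rw [Complex.ofReal_div, eq_div_iff (by exact_mod_cast hr.ne')]
  exact (hts.trans (congrArg (z * ·) hrs.symm)).symm

theorem posSemidef_sub_smul_one {D : ℕ} {A : Matrix (Fin D) (Fin D) ℂ} (hA : A.IsHermitian) {c : ℝ}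
    (h : ∀ a : ℝ, Module.End.HasEigenvalue (Matrix.toLin' A) (a : ℂ) → c ≤ a) :
    (A - (c : ℂ) • (1 : Matrix (Fin D) (Fin D) ℂ)).PosSemidef := by
  have hB : (A - (c : ℂ) • (1 : Matrix (Fin D) (Fin D) ℂ)).IsHermitian := by
    refine hA.sub ?_
    rw [Matrix.IsHermitian, Matrix.conjTranspose_smul, Matrix.conjTranspose_one]
    simp
  refine hB.posSemidef_iff_eigenvalues_nonneg.2 fun i => ?_
  set v : Fin D → ℂ := (hB.eigenvectorBasis i).ofLp with hv
  have h1 := hB.mulVec_eigenvectorBasis i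
  have hv0 : v ≠ 0 := fun h0 => hB.eigenvectorBasis.orthonormal.ne_zero i (by
    ext k
    exact congrFun h0 k)
  have h2 : A *ᵥ v = ((hB.eigenvalues i + c : ℝ) : ℂ) • v := by
    rw [Matrix.sub_mulVec, Matrix.smul_mulVec, Matrix.one_mulVec, sub_eq_iff_eq_add] at h1
    rw [h1]
    ext k
    simp [hv, add_mul]
  have h3 := h _ (Module.End.hasEigenvalue_of_hasEigenvector (x := v)
    ⟨Module.End.mem_eigenspace_iff.2 h2, hv0⟩)
  simpa using h3

variable {Ω : Type*} [MeasurableSpace Ω] {P : Measure Ω}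
variable {H : Type*} [NormedAddCommGroup H] [InnerProductSpace ℝ H] [CompleteSpace H]
variable {ε X : ℤ → Lp H 2 P} {ψ π : ℕ → H →L[ℝ] H} {ν : HilbertBasis ℕ ℝ H} {D : ℕ}

/-! ### The spectral bound -/

theorem hasSum_covMatrix (hε : IsWhiteNoise ε) (hX : IsLinearProcess ψ ε X)
    (hψ : Summable fun j => ‖ψ j‖) (ω : ℝ) (k l : Fin D) :
    HasSum (fun h : ℤ => expNeg ω h * (covMatrix ν X D h k l : ℂ))
      (2 * Real.pi * spectralDensity ν X D ω k l) := by
  have h1 : (2 * Real.pi * spectralDensity ν X D ω k l : ℂ) = noiseGram ν ψ ε D ω k l := by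
    rw [spectralDensity_eq ν hε hX hψ, Matrix.smul_apply, smul_eq_mul, ← mul_assoc,
      mul_one_div_cancel, one_mul]
    simp [Real.pi_ne_zero]
  rw [h1]
  exact Pi.hasSum.1 (Pi.hasSum.1 (hasSum_spectralTerm ν hε hX hψ D ω) k) l

theorem summable_abs_covMatrix (hε : IsWhiteNoise ε) (hX : IsLinearProcess ψ ε X)
    (hψ : Summable fun j => ‖ψ j‖) (k l : Fin D) :
    Summable fun h : ℤ => |covMatrix ν X D h k l| := by
  have := (hasSum_covMatrix (ν := ν) hε hX hψ 0 k l).summable.norm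
  simpa [norm_expNeg] using this

theorem continuous_spectralDensity (hε : IsWhiteNoise ε) (hX : IsLinearProcess ψ ε X)
    (hψ : Summable fun j => ‖ψ j‖) (k l : Fin D) :
    Continuous fun ω => spectralDensity ν X D ω k l := by
  have h1 (ω : ℝ) : spectralDensity ν X D ω k l
      = (2 * Real.pi : ℂ)⁻¹ * ∑' h : ℤ, expNeg ω h * (covMatrix ν X D h k l : ℂ) := by
    rw [(hasSum_covMatrix hε hX hψ ω k l).tsum_eq, ← mul_assoc, inv_mul_cancel₀, one_mul]
    simp [Real.pi_ne_zero]
  simp only [h1]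
  refine continuous_const.mul (continuous_tsum (fun h => ?_)
    (summable_abs_covMatrix (ν := ν) hε hX hψ k l) fun h ω => ?_)
  · simp only [expNeg]
    fun_prop
  · rw [norm_mul, norm_expNeg, one_mul, Complex.norm_real, Real.norm_eq_abs]

/-- By compactness, the eigenvalues of the spectral density matrices are bounded away from zero. -/
theorem exists_pos_le_eigenvalue (hε : IsWhiteNoise ε) (hX : IsLinearProcess ψ ε X)
    (hinv : IsInverseRepresentation π ε X)
    (hinj : ∀ x, crossCov (ε 0) (ε 0) x = 0 → x = 0)
    (hψ : Summable fun j => ‖ψ j‖) (hD : 0 < D) :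
    ∃ c, 0 < c ∧ ∀ ω ∈ Set.Ioc (-Real.pi) Real.pi, ∀ a : ℝ,
      Module.End.HasEigenvalue (Matrix.toLin' (spectralDensity ν X D ω)) (a : ℂ) → c ≤ a := by
  have : Nonempty (Fin D) := ⟨⟨0, hD⟩⟩
  set q : ℝ × (Fin D → ℂ) → ℝ :=
    fun p => (star p.2 ⬝ᵥ spectralDensity ν X D p.1 *ᵥ p.2).re with hq
  have hcont : Continuous q := by
    simp only [hq, dotProduct, Matrix.mulVec, Pi.star_apply]
    refine Complex.continuous_re.comp (continuous_finsetSum _ fun k _ => Continuous.mul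
      (by fun_prop) (continuous_finsetSum _ fun l _ => Continuous.mul ?_ (by fun_prop)))
    exact (continuous_spectralDensity hε hX hψ k l).comp continuous_fst
  set K : Set (ℝ × (Fin D → ℂ)) := Set.Icc (-Real.pi) Real.pi ×ˢ Metric.sphere 0 1 with hK
  have hKc : IsCompact K := isCompact_Icc.prod (isCompact_sphere 0 1)
  have hKne : K.Nonempty :=
    Set.Nonempty.prod (Set.nonempty_Icc.2 (by linarith [Real.pi_pos]))
      (NormedSpace.sphere_nonempty.2 zero_le_one)
  obtain ⟨p, hpK, hp⟩ := hKc.exists_isMinOn hKne hcont.continuousOn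
  have hp0 : 0 < q p := by
    have hne : p.2 ≠ 0 := by
      intro h0
      have := hpK.2
      rw [h0] at this
      simp at this
    have := (posDef_spectralDensity ν hε hX hinv hinj hψ D p.1).dotProduct_mulVec_pos hne
    exact (Complex.pos_iff.1 this).1
  refine ⟨q p / D, by positivity, fun ω hω a ha => ?_⟩
  obtain ⟨v, hv⟩ := ha.exists_hasEigenvector
  have hv0 : ‖v‖ ≠ 0 := norm_ne_zero_iff.2 hv.2
  -- normalize the eigenvector in the supremum norm
  set w : Fin D → ℂ := (‖v‖⁻¹ : ℂ) • v with hw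
  have hwn : ‖w‖ = 1 := by
    rw [hw, norm_smul, norm_inv, Complex.norm_real, norm_norm, inv_mul_cancel₀ hv0]
  have hAw : spectralDensity ν X D ω *ᵥ w = (a : ℂ) • w := by
    have : spectralDensity ν X D ω *ᵥ v = (a : ℂ) • v := by simpa using hv.apply_eq_smul
    rw [hw, Matrix.mulVec_smul, this, smul_comm]
  have h1 : q p ≤ q (ω, w) := hp ⟨⟨hω.1.le, hω.2⟩, by simpa using hwn⟩
  have h2 : star w ⬝ᵥ w = ((∑ k, ‖w k‖ ^ 2 : ℝ) : ℂ) := by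
    simp [dotProduct, Complex.conj_mul']
  have h3 : q (ω, w) = a * ∑ k, ‖w k‖ ^ 2 := by
    simp only [hq, hAw, dotProduct_smul, h2, smul_eq_mul]
    rw [← Complex.ofReal_mul, Complex.ofReal_re]
  have h4 : ∑ k, ‖w k‖ ^ 2 ≤ D := by
    have : ∑ k : Fin D, ‖w k‖ ^ 2 ≤ ∑ k : Fin D, (1 : ℝ) :=
      Finset.sum_le_sum fun k _ => pow_le_one₀ (norm_nonneg _) (hwn ▸ norm_le_pi_norm w k)
    simpa using this
  have hDpos : (0 : ℝ) < D := by exact_mod_cast hD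
  have h5 : 0 ≤ ∑ k, ‖w k‖ ^ 2 := Finset.sum_nonneg fun _ _ => by positivity
  rw [div_le_iff₀ hDpos]
  have ha0 : 0 < a := by
    by_contra hneg
    nlinarith [mul_nonneg (neg_nonneg.2 (not_lt.1 hneg)) h5]
  nlinarith

theorem alpha_pos (hε : IsWhiteNoise ε) (hX : IsLinearProcess ψ ε X)
    (hinv : IsInverseRepresentation π ε X)
    (hinj : ∀ x, crossCov (ε 0) (ε 0) x = 0 → x = 0)
    (hψ : Summable fun j => ‖ψ j‖) (hD : 0 < D) : 0 < alpha ν X D := by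
  have : Nonempty (Fin D) := ⟨⟨0, hD⟩⟩
  obtain ⟨c, hc, h⟩ := exists_pos_le_eigenvalue (ν := ν) hε hX hinv hinj hψ hD
  refine hc.trans_le (le_csInf ?_ ?_)
  · obtain ⟨z, hz⟩ := Module.End.exists_eigenvalue (Matrix.toLin' (spectralDensity ν X D 0))
    obtain ⟨a, _, rfl⟩ :=
      exists_pos_of_hasEigenvalue (posDef_spectralDensity ν hε hX hinv hinj hψ D 0) hz
    exact ⟨a, 0, ⟨by linarith [Real.pi_pos], Real.pi_pos.le⟩, hz⟩
  · rintro a ⟨ω, hω, ha⟩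
    exact h ω hω a ha

theorem spectralDensity_isHermitian_and_pos (hε : IsWhiteNoise ε) (hX : IsLinearProcess ψ ε X)
    (hinv : IsInverseRepresentation π ε X)
    (hinj : ∀ x, crossCov (ε 0) (ε 0) x = 0 → x = 0)
    (hψ : Summable fun j => ‖ψ j‖) (ω : ℝ) :
    (spectralDensity ν X D ω).IsHermitian ∧
      ∀ z : ℂ, Module.End.HasEigenvalue (Matrix.toLin' (spectralDensity ν X D ω)) z →
        ∃ a : ℝ, 0 < a ∧ z = a :=
  have hpd := posDef_spectralDensity ν hε hX hinv hinj hψ D ω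
  ⟨hpd.isHermitian, fun _ hz => exists_pos_of_hasEigenvalue hpd hz⟩

theorem posSemidef_spectralDensity_sub_alpha (hε : IsWhiteNoise ε) (hX : IsLinearProcess ψ ε X)
    (hinv : IsInverseRepresentation π ε X)
    (hinj : ∀ x, crossCov (ε 0) (ε 0) x = 0 → x = 0)
    (hψ : Summable fun j => ‖ψ j‖) (hD : 0 < D) {ω : ℝ}
    (hω : ω ∈ Set.Ioc (-Real.pi) Real.pi) :
    (spectralDensity ν X D ω
      - (alpha ν X D : ℂ) • (1 : Matrix (Fin D) (Fin D) ℂ)).PosSemidef := by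
  obtain ⟨c, _, h⟩ := exists_pos_le_eigenvalue (ν := ν) hε hX hinv hinj hψ hD
  refine posSemidef_sub_smul_one (posDef_spectralDensity ν hε hX hinv hinj hψ D ω).isHermitian
    fun a ha => csInf_le ⟨c, ?_⟩ ⟨ω, hω, ha⟩
  rintro b ⟨ω', hω', hb⟩
  exact h ω' hω' b hb

/-! ### From the spectral density back to the time domain -/

theorem integral_expNeg (n : ℤ) :
    ∫ ω in -Real.pi..Real.pi, expNeg ω n = if n = 0 then (2 * Real.pi : ℂ) else 0 := by
  split_ifs with hn
  · subst hn
    simp only [expNeg_zero, intervalIntegral.integral_const]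
    simp [two_mul]
  · have hc : -Complex.I * n ≠ 0 := by simp [hn]
    have h := integral_exp_mul_complex (a := -Real.pi) (b := Real.pi) hc
    rw [show (∫ ω in -Real.pi..Real.pi, expNeg ω n)
      = ∫ ω in -Real.pi..Real.pi, Complex.exp (-Complex.I * n * ω) from rfl, h]
    have h2 : Complex.exp (-Complex.I * n * Real.pi)
        = Complex.exp (-Complex.I * n * (-Real.pi : ℝ)) := by
      rw [Complex.exp_eq_exp_iff_exists_int]
      refine ⟨-n, ?_⟩
      push_cast
      ring
    rw [h2, sub_self, zero_div]

/-- Fourier inversion for the spectral density. -/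
theorem integral_expNeg_mul_spectralDensity (hε : IsWhiteNoise ε) (hX : IsLinearProcess ψ ε X)
    (hψ : Summable fun j => ‖ψ j‖) (n : ℤ) (k l : Fin D) :
    ∫ ω in -Real.pi..Real.pi, expNeg ω (-n) * spectralDensity ν X D ω k l
      = covMatrix ν X D n k l := by
  have hs := summable_abs_covMatrix (ν := ν) hε hX hψ k l
  have h1 := intervalIntegral.hasSum_integral_of_dominated_convergence (a := -Real.pi)
    (b := Real.pi) (μ := volume)
    (F := fun (h : ℤ) ω => expNeg ω (-n) * (expNeg ω h * (covMatrix ν X D h k l : ℂ)))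
    (f := fun ω => expNeg ω (-n) * (2 * Real.pi * spectralDensity ν X D ω k l))
    (fun h _ => |covMatrix ν X D h k l|)
    (fun h => (by simp only [expNeg]; fun_prop : Continuous _).aestronglyMeasurable)
    (fun h => ae_of_all _ fun ω _ => by
      simp [norm_expNeg])
    (ae_of_all _ fun ω _ => hs) (by simp)
    (ae_of_all _ fun ω _ => (hasSum_covMatrix hε hX hψ ω k l).mul_left _)
  have h2 (h : ℤ) : ∫ ω in -Real.pi..Real.pi,
      expNeg ω (-n) * (expNeg ω h * (covMatrix ν X D h k l : ℂ))
      = if h = n then 2 * Real.pi * (covMatrix ν X D n k l : ℂ) else 0 := by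
    simp only [← mul_assoc, ← expNeg_add]
    rw [intervalIntegral.integral_mul_const, integral_expNeg]
    by_cases hn : h = n
    · subst hn
      simp
    · have : -n + h ≠ 0 := by omega
      simp [hn, this]
  simp only [h2] at h1
  have h3 := h1.unique (hasSum_ite_eq n _)
  simp only [mul_left_comm (expNeg _ _) (2 * Real.pi : ℂ)] at h3
  rw [intervalIntegral.integral_const_mul] at h3
  exact mul_left_cancel₀ (by simp [Real.pi_ne_zero]) h3

end Alpha

section LowerBound

open scoped ComplexOrder Matrix

/-! ### Variances of linear combinations of observations -/

/-- If the Fourier coefficients of a positive semidefinite matrix function are `B`, then `B` is a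
positive semidefinite kernel. -/
theorem sum_fourierCoeff_nonneg {D : ℕ} {M : ℝ → Matrix (Fin D) (Fin D) ℂ}
    {B : ℤ → Matrix (Fin D) (Fin D) ℝ} (hM : ∀ k l, Continuous fun ω => M ω k l)
    (hB : ∀ n k l, ∫ ω in -Real.pi..Real.pi, expNeg ω (-n) * M ω k l = B n k l)
    (hpos : ∀ ω ∈ Set.Ioc (-Real.pi) Real.pi, (M ω).PosSemidef) (s : Finset ℕ)
    (c : ℕ → Fin D → ℝ) :
    0 ≤ ∑ t ∈ s, ∑ u ∈ s, ∑ k, ∑ l, c t k * c u l * B (t - u) k l := by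
  set ξ : ℝ → Fin D → ℂ := fun ω k => ∑ t ∈ s, expNeg ω t * c t k with hξ
  have hexp (ω : ℝ) : star (ξ ω) ⬝ᵥ M ω *ᵥ ξ ω = ∑ t ∈ s, ∑ u ∈ s, ∑ k, ∑ l,
      (c t k * c u l : ℂ) * (expNeg ω (-(t - u : ℤ)) * M ω k l) := by
    have h1 (t u : ℕ) : expNeg ω (-(t - u : ℤ)) = expNeg ω (-t) * expNeg ω u := by
      rw [← expNeg_add]
      congr 1
      ring
    have h2 (k : Fin D) : star (ξ ω) k = ∑ t ∈ s, expNeg ω (-t) * c t k := by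
      simp only [hξ, Pi.star_apply, star_sum, star_mul', RCLike.star_def, star_expNeg,
        Complex.conj_ofReal]
    simp only [dotProduct, Matrix.mulVec, h2, h1]
    simp only [Finset.sum_comm (s := s) (t := (Finset.univ : Finset (Fin D)))]
    refine Finset.sum_congr rfl fun k _ => ?_
    rw [Finset.mul_sum]
    refine Finset.sum_congr rfl fun l _ => ?_
    rw [Finset.sum_mul]
    refine Finset.sum_congr rfl fun t _ => ?_
    rw [hξ, Finset.mul_sum, Finset.mul_sum]
    exact Finset.sum_congr rfl fun u _ => by ring
  have hcont (t u : ℕ) (k l : Fin D) : Continuous fun ω =>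
      (c t k * c u l : ℂ) * (expNeg ω (-(t - u : ℤ)) * M ω k l) := by
    have := hM k l
    simp only [expNeg]
    fun_prop
  have hint : ∫ ω in -Real.pi..Real.pi, star (ξ ω) ⬝ᵥ M ω *ᵥ ξ ω
      = ((∑ t ∈ s, ∑ u ∈ s, ∑ k, ∑ l, c t k * c u l * B (t - u) k l : ℝ) : ℂ) := by
    simp only [hexp]
    push_cast
    rw [intervalIntegral.integral_finsetSum fun t _ => (continuous_finsetSum _ fun u _ =>
      continuous_finsetSum _ fun k _ => continuous_finsetSum _ fun l _ =>
        hcont t u k l).intervalIntegrable _ _]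
    refine Finset.sum_congr rfl fun t _ => ?_
    rw [intervalIntegral.integral_finsetSum fun u _ => (
      continuous_finsetSum _ fun k _ => continuous_finsetSum _ fun l _ =>
        hcont t u k l).intervalIntegrable _ _]
    refine Finset.sum_congr rfl fun u _ => ?_
    rw [intervalIntegral.integral_finsetSum fun k _ => (continuous_finsetSum _ fun l _ =>
        hcont t u k l).intervalIntegrable _ _]
    refine Finset.sum_congr rfl fun k _ => ?_
    rw [intervalIntegral.integral_finsetSum fun l _ => (hcont t u k l).intervalIntegrable _ _]
    refine Finset.sum_congr rfl fun l _ => ?_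
    rw [intervalIntegral.integral_const_mul, hB]
  have hcont' : Continuous fun ω => star (ξ ω) ⬝ᵥ M ω *ᵥ ξ ω := by
    simp only [hexp]
    exact continuous_finsetSum _ fun t _ => continuous_finsetSum _ fun u _ =>
      continuous_finsetSum _ fun k _ => continuous_finsetSum _ fun l _ => hcont t u k l
  have hre : ∫ ω in -Real.pi..Real.pi, (star (ξ ω) ⬝ᵥ M ω *ᵥ ξ ω).re
      = ∑ t ∈ s, ∑ u ∈ s, ∑ k, ∑ l, c t k * c u l * B (t - u) k l := by
    have := Complex.reCLM.intervalIntegral_comp_comm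
      (hcont'.intervalIntegrable (μ := volume) (-Real.pi) Real.pi)
    rw [hint] at this
    simpa only [Complex.reCLM_apply, Complex.ofReal_re] using this
  rw [← hre, intervalIntegral.integral_of_le (by linarith [Real.pi_pos])]
  exact setIntegral_nonneg measurableSet_Ioc fun ω hω =>
    (Complex.nonneg_iff.1 ((hpos ω hω).dotProduct_mulVec_nonneg _)).1

variable {Ω : Type*} [MeasurableSpace Ω] {P : Measure Ω}
variable {H : Type*} [NormedAddCommGroup H] [InnerProductSpace ℝ H] [CompleteSpace H]
variable {ε X : ℤ → Lp H 2 P} {ψ π : ℕ → H →L[ℝ] H} {ν : HilbertBasis ℕ ℝ H} {D : ℕ}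

theorem inner_compLp_process_eq_sum (hstat : IsWeaklyStationary X) {x y : H}
    (hx : x ∈ basisSpan ν D) (hy : y ∈ basisSpan ν D) (t u : ℕ) :
    inner ℝ ((innerSL ℝ x).compLp (X t)) ((innerSL ℝ y).compLp (X u))
      = ∑ k : Fin D, ∑ l : Fin D,
        inner ℝ (ν k) x * inner ℝ (ν l) y * covMatrix ν X D (t - u) k l := by
  have h1 : crossCov (X u) (X t) = lagCov X (t - u) := by
    rw [lagCov, ← hstat.cov_eq u]
    congr 2
    ring
  have h2 (k l : Fin D) :
      covMatrix ν X D (t - u) k l = inner ℝ (lagCov X (t - u) (ν l)) (ν k) := by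
    rw [lagCov, inner_crossCov, covMatrix, Matrix.of_apply]
    simp only [mul_comm]
  rw [real_inner_comm, ← inner_crossCov_eq_inner, h1]
  conv_lhs => rw [← sum_inner_smul_of_mem hx, ← sum_inner_smul_of_mem hy]
  simp only [map_sum, map_smul, inner_sum, sum_inner, real_inner_smul_left,
    real_inner_smul_right, ← h2]
  exact Finset.sum_congr rfl fun k _ => Finset.sum_congr rfl fun l _ => by ring

/-- The spectral bound in the time domain: linear combinations of the observations with coefficients
in `A_D` have variance at least `2π α_D` times the sum of the squared norms of the coefficients. -/
theorem alpha_mul_sum_le (hε : IsWhiteNoise ε) (hX : IsLinearProcess ψ ε X)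
    (hstat : IsWeaklyStationary X) (hinv : IsInverseRepresentation π ε X)
    (hinj : ∀ x, crossCov (ε 0) (ε 0) x = 0 → x = 0)
    (hψ : Summable fun j => ‖ψ j‖) (hD : 0 < D) (s : Finset ℕ) {x : ℕ → H}
    (hx : ∀ t ∈ s, x t ∈ basisSpan ν D) :
    2 * Real.pi * alpha ν X D * ∑ t ∈ s, ‖x t‖ ^ 2
      ≤ ‖∑ t ∈ s, (innerSL ℝ (x t)).compLp (X t)‖ ^ 2 := by
  set α := alpha ν X D with hα
  set B : ℤ → Matrix (Fin D) (Fin D) ℝ := fun n => covMatrix ν X D n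
    - (if n = 0 then 2 * Real.pi * α else 0) • (1 : Matrix (Fin D) (Fin D) ℝ) with hBdef
  have h0 := sum_fourierCoeff_nonneg
    (M := fun ω => spectralDensity ν X D ω - (α : ℂ) • (1 : Matrix (Fin D) (Fin D) ℂ)) (B := B)
    (fun k l => (continuous_spectralDensity hε hX hψ k l).sub continuous_const)
    (fun n k l => by
      have hc : Continuous fun ω => expNeg ω (-n) := by
        simp only [expNeg]
        fun_prop
      simp only [Matrix.sub_apply, mul_sub, Matrix.smul_apply, smul_eq_mul]
      rw [intervalIntegral.integral_sub, integral_expNeg_mul_spectralDensity hε hX hψ,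
        intervalIntegral.integral_mul_const, integral_expNeg]
      · by_cases hn : n = 0 <;> by_cases hkl : k = l <;>
          simp [hBdef, hn, hkl, Matrix.one_apply, mul_assoc]
      · exact (hc.mul (continuous_spectralDensity hε hX hψ k l)).intervalIntegrable _ _
      · exact (hc.mul continuous_const).intervalIntegrable _ _)
    (fun ω hω => posSemidef_spectralDensity_sub_alpha hε hX hinv hinj hψ hD hω) s
    (fun t k => inner ℝ (ν k) (x t))
  have h1 : ‖∑ t ∈ s, (innerSL ℝ (x t)).compLp (X t)‖ ^ 2
      = ∑ t ∈ s, ∑ u ∈ s, ∑ k : Fin D, ∑ l : Fin D,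
        inner ℝ (ν k) (x t) * inner ℝ (ν l) (x u) * covMatrix ν X D (t - u) k l := by
    rw [← real_inner_self_eq_norm_sq, sum_inner]
    refine Finset.sum_congr rfl fun t ht => ?_
    rw [inner_sum]
    exact Finset.sum_congr rfl fun u hu =>
      inner_compLp_process_eq_sum hstat (hx t ht) (hx u hu) t u
  have h2 : 2 * Real.pi * α * ∑ t ∈ s, ‖x t‖ ^ 2
      = ∑ t ∈ s, ∑ u ∈ s, ∑ k : Fin D, ∑ l : Fin D,
        inner ℝ (ν k) (x t) * inner ℝ (ν l) (x u) * ((if (t - u : ℤ) = 0 then 2 * Real.pi * α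
          else 0) • (1 : Matrix (Fin D) (Fin D) ℝ)) k l := by
    rw [Finset.mul_sum]
    refine Finset.sum_congr rfl fun t ht => ?_
    rw [Finset.sum_eq_single_of_mem t ht]
    · rw [norm_sq_of_mem_basisSpan (hx t ht), Finset.mul_sum]
      refine Finset.sum_congr rfl fun k _ => ?_
      rw [Finset.sum_eq_single_of_mem k (Finset.mem_univ k)]
      · simp
        ring
      · intro l _ hl
        simp [Matrix.one_apply_ne hl.symm]
    · intro u _ hu
      have : ¬ (t - u : ℤ) = 0 := by omega
      simp [this]
  rw [h1, h2, ← sub_nonneg]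
  simp only [← Finset.sum_sub_distrib, ← mul_sub]
  exact h0

end LowerBound

section Convergence

variable {Ω : Type*} [MeasurableSpace Ω] {P : Measure Ω}
variable {H : Type*} [NormedAddCommGroup H] [InnerProductSpace ℝ H] [CompleteSpace H]
variable {ε X : ℤ → Lp H 2 P} {ψ π : ℕ → H →L[ℝ] H} {ν : HilbertBasis ℕ ℝ H} {d m : ℕ → ℕ}

/-! ### Convergence of the coefficients -/

/-- The variances of the innovations are bounded below by the spectral bound, because the
coefficient of the newest observation in an innovation is the identity. -/
theorem alpha_mul_le_innovation (hε : IsWhiteNoise ε) (hX : IsLinearProcess ψ ε X)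
    (hstat : IsWeaklyStationary X) (hinv : IsInverseRepresentation π ε X)
    (hinj : ∀ x, crossCov (ε 0) (ε 0) x = 0 → x = 0)
    (hψ : Summable fun j => ‖ψ j‖) (hd_pos : ∀ n, 0 < d n) (hd_mono : Monotone d) {k n : ℕ}
    (hk : k < n) {z : H} (hz : z ∈ basisSpan ν (d (k + 1))) :
    2 * Real.pi * alpha ν X (d n) * ‖z‖ ^ 2
      ≤ ‖(innerSL ℝ z).compLp (innovation ν d X k)‖ ^ 2 := by
  obtain ⟨B, hB⟩ := exists_algPredictor_eq ν d X k
  -- the coefficients, in `A_{d_n}`, of the functional `⟨z, ·⟩` of the innovation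
  set x : ℕ → H := fun t => if t = k + 1 then z else if t = 0 then 0 else
    -proj ν (d t) (ContinuousLinearMap.adjoint (B (t - 1)) z) with hx
  have hmem (t : ℕ) (ht : t ∈ Finset.range (k + 2)) : x t ∈ basisSpan ν (d n) := by
    have ht' := Finset.mem_range.1 ht
    simp only [hx]
    split_ifs with h1 h2
    · exact basisSpan_mono ν (hd_mono hk) hz
    · exact zero_mem _
    · exact neg_mem (basisSpan_mono ν (hd_mono (by omega)) (proj_mem ν _ _))
  have hsum : (innerSL ℝ z).compLp (innovation ν d X k)
      = ∑ t ∈ Finset.range (k + 2), (innerSL ℝ (x t)).compLp (X t) := by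
    have hxz : x (k + 1) = z := by simp [hx]
    have hx0 : x 0 = 0 := by simp [hx]
    have hxt (t : ℕ) (ht : t < k) :
        x (t + 1) = -proj ν (d (t + 1)) (ContinuousLinearMap.adjoint (B t) z) := by
      have : t ≠ k := by omega
      simp [hx, this]
    have h0 : (innerSL ℝ (0 : H)).compLp (X (0 : ℕ)) = 0 := by
      rw [map_zero]
      exact map_zero (evalOn (F := ℝ) (X (0 : ℕ)))
    rw [Finset.sum_range_succ, Finset.sum_range_succ', hxz, hx0, h0, add_zero, innovation, hB,
      compLp_sub_right, compLp_sum_right, projX, ← comp_compLp,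
      ContinuousLinearMap.innerSL_apply_comp, adjoint_proj, proj_eq_self_iff.2 hz,
      sub_eq_neg_add, ← Finset.sum_neg_distrib]
    congr 1
    refine Finset.sum_congr rfl fun t ht => ?_
    rw [hxt t (Finset.mem_range.1 ht), projX, ← comp_compLp, ← comp_compLp,
      ContinuousLinearMap.innerSL_apply_comp, ContinuousLinearMap.innerSL_apply_comp, adjoint_proj,
      map_neg]
    exact (map_neg (evalOn (X (t + 1 : ℕ))) _).symm
  have h := alpha_mul_sum_le hε hX hstat hinv hinj hψ (hd_pos n) (Finset.range (k + 2)) hmem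
  rw [hsum]
  refine le_trans (mul_le_mul_of_nonneg_left ?_ ?_) h
  · have h1 := Finset.single_le_sum (f := fun t => ‖x t‖ ^ 2) (fun t _ => by positivity)
      (Finset.mem_range.2 (show k + 1 < k + 2 by omega))
    simpa [hx] using h1
  · have := alpha_pos (ν := ν) hε hX hinv hinj hψ (hd_pos n)
    positivity

/-- The coefficients `θ_{n,i}`, extended to `i = 0` by the projection on `A_{d_{n+1}}`. -/
noncomputable def thetaExt (ν : HilbertBasis ℕ ℝ H) (d : ℕ → ℕ) (X : ℤ → Lp H 2 P)
    (n i : ℕ) : H →L[ℝ] H :=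
  if i = 0 then proj ν (d (n + 1)) else theta (lagCov X) ν d n i

theorem crossCov_innovation_projX (hε : IsWhiteNoise ε) (hX : IsLinearProcess ψ ε X)
    (hstat : IsWeaklyStationary X) (hinj : ∀ x, crossCov (ε 0) (ε 0) x = 0 → x = 0) {k t : ℕ}
    (h : k ≤ t) :
    crossCov (innovation ν d X k) (projX ν d X (t + 1))
      = thetaExt ν d X t (t - k) ∘L crossCov (innovation ν d X k) (innovation ν d X k) := by
  rcases h.eq_or_lt with rfl | h
  · have h1 : crossCov (innovation ν d X k) (algPredictor ν d X k) = 0 :=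
      lcs_observations_le_innovation hε hX hstat hinj k (algPredictor_mem_lcs ν d X k)
    rw [thetaExt, if_pos (Nat.sub_self k), ← crossCov_compLp_right, proj_compLp_innovation]
    conv_rhs => rw [innovation, crossCov_sub_right, ← innovation, h1, sub_zero]
  · rw [thetaExt, if_neg (by omega), ← (innovations_algorithm hε hX hstat hinj k).2.2,
      (innovations_algorithm hε hX hstat hinj t).1 k h]

/-- The defect of the coefficients `θ_{n,i}` in the recursion of the moving average coefficients. -/
noncomputable def recursionDefect (ν : HilbertBasis ℕ ℝ H) (d : ℕ → ℕ) (X : ℤ → Lp H 2 P)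
    (π : ℕ → H →L[ℝ] H) (n i : ℕ) : H →L[ℝ] H :=
  theta (lagCov X) ν d n i
    - ∑ j ∈ Finset.range i, π (j + 1) ∘L thetaExt ν d X (n - (j + 1)) (i - (j + 1))

theorem crossCov_innovation_sub (hε : IsWhiteNoise ε) (hX : IsLinearProcess ψ ε X)
    (hstat : IsWeaklyStationary X) (hinj : ∀ x, crossCov (ε 0) (ε 0) x = 0 → x = 0) {M n i : ℕ}
    (hi : 0 < i) (hiM : i ≤ M) (hMn : M ≤ n) :
    crossCov (innovation ν d X (n - i)) (algPredictor ν d X n - truncatedPredictor ν d X π M n)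
      = recursionDefect ν d X π n i
        ∘L crossCov (innovation ν d X (n - i)) (innovation ν d X (n - i)) := by
  set k := n - i with hk
  have hkn : k < n := by omega
  have h1 : crossCov (innovation ν d X k) (algPredictor ν d X n)
      = theta (lagCov X) ν d n i
        ∘L crossCov (innovation ν d X k) (innovation ν d X k) := by
    have h2 : crossCov (innovation ν d X k) (innovation ν d X n) = 0 :=
      (innovations_algorithm hε hX hstat hinj n).2.1 k hkn
    have h3 := crossCov_innovation_projX (ν := ν) (d := d) hε hX hstat hinj hkn.le
    have h4 : n - k = i := by omega
    rw [h4, thetaExt, if_neg hi.ne'] at h3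
    rw [← h3, ← sub_eq_zero, ← neg_eq_zero, neg_sub, ← crossCov_sub_right]
    exact h2
  rw [crossCov_sub_right, h1, recursionDefect, ContinuousLinearMap.sub_comp,
    ContinuousLinearMap.finsetSum_comp, truncatedPredictor, crossCov_sum_right]
  congr 1
  rw [← Finset.sum_subset (Finset.range_mono hiM)]
  · refine Finset.sum_congr rfl fun j hj => ?_
    have hj' := Finset.mem_range.1 hj
    have h5 : n - j = (n - (j + 1)) + 1 := by omega
    have h6 : n - (j + 1) - k = i - (j + 1) := by omega
    rw [crossCov_compLp_right, h5, crossCov_innovation_projX hε hX hstat hinj (by omega), h6]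
    rfl
  · -- observations before time `k + 1` are uncorrelated with the innovation
    intro j hj hji
    have hj' := Finset.mem_range.1 hj
    have hji' : i ≤ j := by simpa using hji
    have h7 : crossCov (innovation ν d X k) (projX ν d X (n - j)) = 0 :=
      lcs_observations_le_innovation hε hX hstat hinj k
        (subset_lcs _ ⟨n - j, by omega, by omega, rfl⟩)
    rw [crossCov_compLp_right, h7, ContinuousLinearMap.comp_zero]

theorem recursionDefect_comp_proj {n i : ℕ} (hi : 0 < i) (hin : i ≤ n) :
    recursionDefect ν d X π n i ∘L proj ν (d (n - i + 1)) = recursionDefect ν d X π n i := by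
  have h1 (t : ℕ) (ht : n - i ≤ t) :
      thetaExt ν d X t (t - (n - i)) ∘L proj ν (d (n - i + 1))
        = thetaExt ν d X t (t - (n - i)) := by
    rcases ht.eq_or_lt with rfl | ht
    · rw [thetaExt, if_pos (Nat.sub_self _), proj_comp_proj]
    · rw [thetaExt, if_neg (by omega), theta_comp_proj ν d _ ht]
  have h2 : theta (lagCov X) ν d n i ∘L proj ν (d (n - i + 1)) = theta (lagCov X) ν d n i := by
    have h3 := theta_comp_proj ν d (lagCov X) (show n - i < n by omega)
    rwa [Nat.sub_sub_self hin] at h3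
  rw [recursionDefect, ContinuousLinearMap.sub_comp, ContinuousLinearMap.finsetSum_comp, h2]
  congr 1
  refine Finset.sum_congr rfl fun j hj => ?_
  have hj' := Finset.mem_range.1 hj
  have h4 := h1 (n - (j + 1)) (by omega)
  have h5 : n - (j + 1) - (n - i) = i - (j + 1) := by omega
  rw [h5] at h4
  rw [ContinuousLinearMap.comp_assoc, h4]

/-- With `z = Γ* y`, where `Γ` is the defect, the variance of `⟨z, e_{n-i}⟩` equals the covariance
of `⟨z, e_{n-i}⟩` and `⟨y, Y⟩`, where `Y` is the difference of the predictors; the inequality of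
Cauchy and Schwarz and the spectral bound give the estimate. -/
theorem alpha_mul_norm_recursionDefect_le (hε : IsWhiteNoise ε) (hX : IsLinearProcess ψ ε X)
    (hstat : IsWeaklyStationary X) (hinv : IsInverseRepresentation π ε X)
    (hinj : ∀ x, crossCov (ε 0) (ε 0) x = 0 → x = 0)
    (hψ : Summable fun j => ‖ψ j‖) (hd_pos : ∀ n, 0 < d n) (hd_mono : Monotone d) {M n i : ℕ}
    (hi : 0 < i) (hiM : i ≤ M) (hMn : M ≤ n) :
    2 * Real.pi * alpha ν X (d n) * ‖recursionDefect ν d X π n i‖ ^ 2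
      ≤ ‖algPredictor ν d X n - truncatedPredictor ν d X π M n‖ ^ 2 := by
  set Γ := recursionDefect ν d X π n i with hΓ
  set Y := algPredictor ν d X n - truncatedPredictor ν d X π M n with hY
  set e := innovation ν d X (n - i) with he
  have hα : 0 < 2 * Real.pi * alpha ν X (d n) := by
    have := alpha_pos (ν := ν) hε hX hinv hinj hψ (hd_pos n)
    positivity
  set a := 2 * Real.pi * alpha ν X (d n) with ha
  have hbound (y : H) : ‖ContinuousLinearMap.adjoint Γ y‖ ≤ √(‖Y‖ ^ 2 / a) * ‖y‖ := by
    set z := ContinuousLinearMap.adjoint Γ y with hz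
    have hzmem : z ∈ basisSpan ν (d (n - i + 1)) := by
      rw [← proj_eq_self_iff, hz, hΓ, ← recursionDefect_comp_proj hi (hiM.trans hMn),
        ContinuousLinearMap.adjoint_comp, adjoint_proj, ContinuousLinearMap.comp_apply, proj_proj]
    set S := ‖(innerSL ℝ z).compLp e‖ with hS
    have h1 : S ^ 2 ≤ S * (‖y‖ * ‖Y‖) := by
      have h2 : inner ℝ (crossCov e Y z) y = S ^ 2 := by
        rw [crossCov_innovation_sub hε hX hstat hinj hi hiM hMn, ContinuousLinearMap.comp_apply,
          ← ContinuousLinearMap.adjoint_inner_right, ← hΓ, ← hz, inner_cov_self]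
      rw [← h2, inner_crossCov_eq_inner]
      refine (real_inner_le_norm _ _).trans (mul_le_mul_of_nonneg_left ?_ (norm_nonneg _))
      have h3 := ContinuousLinearMap.norm_compLp_le (innerSL ℝ y) Y
      rwa [innerSL_apply_norm] at h3
    have hS0 : 0 ≤ S := norm_nonneg _
    have h4 : S ≤ ‖y‖ * ‖Y‖ := by
      rcases hS0.eq_or_lt with h0 | h0
      · rw [← h0]
        positivity
      · rw [sq] at h1
        exact le_of_mul_le_mul_left h1 h0
    have h5 : a * ‖z‖ ^ 2 ≤ S ^ 2 :=
      alpha_mul_le_innovation hε hX hstat hinv hinj hψ hd_pos hd_mono (by omega) hzmem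
    refine le_of_sq_le_sq ?_ (by positivity)
    rw [mul_pow, Real.sq_sqrt (by positivity), div_mul_eq_mul_div, le_div_iff₀ hα]
    nlinarith [pow_le_pow_left₀ hS0 h4 2]
  have h6 := ContinuousLinearMap.opNorm_le_bound _ (Real.sqrt_nonneg _) hbound
  rw [LinearIsometryEquiv.norm_map] at h6
  have h7 := pow_le_pow_left₀ (norm_nonneg _) h6 2
  rw [Real.sq_sqrt (by positivity), le_div_iff₀ hα] at h7
  linarith

/-- By induction on `i`: up to a vanishing defect, `θ_{n,i}` is obtained from the `θ_{n-j,i-j}` by the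
recursion that yields `ψ_i` from the `ψ_{i-j}`. -/
theorem tendsto_thetaExt {lam : ℕ → ℝ} (hε : IsWhiteNoise ε) (hX : IsLinearProcess ψ ε X)
    (hstat : IsWeaklyStationary X) (hinv : IsInverseRepresentation π ε X)
    (hinj : ∀ x, crossCov (ε 0) (ε 0) x = 0 → x = 0)
    (heig : ∀ j, lagCov X 0 (ν j) = lam j • ν j) (hlam_pos : ∀ j, 0 < lam j)
    (hψ : Summable fun j => ‖ψ j‖) (hd_pos : ∀ n, 0 < d n) (hd_mono : Monotone d)
    (hm_top : Tendsto m atTop atTop) (hm_lt : ∀ᶠ n in atTop, m n < n)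
    (hd_top : Tendsto d atTop atTop) (i : ℕ) : ∀ u : ℕ → ℕ, Tendsto u atTop atTop →
      (∀ r < i, Tendsto (fun k => 1 / alpha ν X (d (u k - r)) * rateBound π lam m d (u k - r))
        atTop (𝓝 0)) →
      ∀ x : H, Tendsto (fun k => thetaExt ν d X (u k) i x) atTop (𝓝 (ψ i x)) := by
  induction i using Nat.strong_induction_on with
  | _ i ih =>
    intro u hu hrate x
    rcases Nat.eq_zero_or_pos i with rfl | hi
    · simp only [thetaExt, if_true, hX.coeff_zero]
      exact (tendsto_proj ν x).comp (hd_top.comp ((tendsto_add_atTop_nat 1).comp hu))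
    · obtain ⟨K, hK0, hK⟩ :=
        exists_error_bounds (m := m) hε hX hstat hinv hinj heig hlam_pos hd_mono
      have hΓ : Tendsto (fun k => recursionDefect ν d X π (u k) i) atTop (𝓝 0) := by
        have h1 : Tendsto (fun k => ‖recursionDefect ν d X π (u k) i‖ ^ 2) atTop (𝓝 0) := by
          have h2 := (hrate 0 hi).const_mul (K / (2 * Real.pi))
          rw [mul_zero] at h2
          refine tendsto_of_tendsto_of_tendsto_of_le_of_le' tendsto_const_nhds h2
            (Eventually.of_forall fun k => by positivity) ?_
          filter_upwards [hu.eventually hm_lt, (hm_top.comp hu).eventually_ge_atTop i] with k hk hki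
          have h3 := (alpha_mul_norm_recursionDefect_le hε hX hstat hinv hinj hψ hd_pos hd_mono hi
            hki hk.le).trans (hK (u k) hk).2.2
          have hα := alpha_pos (ν := ν) hε hX hinv hinj hψ (hd_pos (u k))
          have h4 (a R : ℝ) : K / (2 * Real.pi) * (1 / a * R) = K * R / (2 * Real.pi * a) := by
            rw [one_div_mul_eq_div, div_mul_div_comm]
          rw [Nat.sub_zero, h4, le_div_iff₀ (by positivity)]
          linarith
        have h2 := h1.sqrt
        simp only [Real.sqrt_sq (norm_nonneg _), Real.sqrt_zero] at h2
        exact tendsto_zero_iff_norm_tendsto_zero.2 h2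
      have hsum : Tendsto (fun k => ∑ j ∈ Finset.range i,
          π (j + 1) (thetaExt ν d X (u k - (j + 1)) (i - (j + 1)) x)) atTop
          (𝓝 (∑ j ∈ Finset.range i, π (j + 1) (ψ (i - (j + 1)) x))) := by
        refine tendsto_finsetSum _ fun j hj => ?_
        have hj' := Finset.mem_range.1 hj
        refine ((π (j + 1)).continuous.tendsto _).comp (ih (i - (j + 1)) (by omega)
          (fun k => u k - (j + 1)) ((tendsto_sub_atTop_nat (j + 1)).comp hu) (fun r hr => ?_) x)
        simp only [Nat.sub_sub]
        exact hrate (j + 1 + r) (by omega)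
      have hadd := (((ContinuousLinearMap.apply ℝ H x).continuous.tendsto _).comp hΓ).add hsum
      have hlim : ψ i x = ContinuousLinearMap.apply ℝ H x (0 : H →L[ℝ] H)
          + ∑ j ∈ Finset.range i, π (j + 1) (ψ (i - (j + 1)) x) := by
        rw [map_zero, zero_add, coeff_recursion hε hX hinv hinj hi, _root_.sum_apply]
        rfl
      rw [hlim]
      refine hadd.congr fun k => ?_
      rw [thetaExt, if_neg hi.ne', Function.comp_apply, ContinuousLinearMap.apply_apply,
        recursionDefect, _root_.sub_apply, _root_.sum_apply]
      exact sub_add_cancel _ _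

end Convergence

end FunctionalLinearProcess

theorem mainTheorem1
    {Ω : Type*} [MeasurableSpace Ω] {P : Measure Ω} [IsProbabilityMeasure P]
    {H : Type*} [NormedAddCommGroup H] [InnerProductSpace ℝ H] [CompleteSpace H]
    (ε X : ℤ → Lp H 2 P) (ψ π : ℕ → H →L[ℝ] H)
    (hε : IsWhiteNoise ε)
    (hX : IsLinearProcess ψ ε X)
    (hstat : IsWeaklyStationary X)
    (hinv : IsInverseRepresentation π ε X)
    -- all eigenvalues of the innovation covariance operator are positive
    (hεpos : ∀ a : ℝ,
      Module.End.HasEigenvalue (crossCov (ε 0) (ε 0) : H →ₗ[ℝ] H) a → 0 < a)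
    -- eigenpairs of the covariance operator of the process, ordered decreasingly and positive
    (ν : HilbertBasis ℕ ℝ H) (lam : ℕ → ℝ)
    (heig : ∀ j, lagCov X 0 (ν j) = lam j • ν j)
    (hlam_anti : Antitone lam) (hlam_pos : ∀ j, 0 < lam j)
    -- the two sequences
    (m d : ℕ → ℕ)
    (hm_mono : Monotone m) (hm_top : Tendsto m atTop atTop)
    (hm_lt : ∀ᶠ n in atTop, m n < n)
    (hm_div : Tendsto (fun n : ℕ => (m n : ℝ) / n) atTop (𝓝 0))
    (hd_pos : ∀ n, 0 < d n) (hd_mono : Monotone d) (hd_top : Tendsto d atTop atTop) :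
    -- (i), for the best linear predictor and for the output of the recursions
    ((excessError ε X (bestPredictor ν d X) =O[atTop] rateBound π lam m d ∧
        excessError ε X (algPredictor ν d X) =O[atTop] rateBound π lam m d) ∧
      Tendsto (rateBound π lam m d) atTop (𝓝 0)) ∧
    -- (ii)
    ((Summable fun j => ‖ψ j‖) →
      -- the spectral density matrices exist and have positive eigenvalues only
      (∀ n, ∀ ω ∈ Set.Ioc (-Real.pi) Real.pi,
        Summable (spectralTerm ν X (d n) ω) ∧
        (spectralDensity ν X (d n) ω).IsHermitian ∧
        ∀ z : ℂ, Module.End.HasEigenvalue (Matrix.toLin' (spectralDensity ν X (d n) ω)) z →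
          ∃ a : ℝ, 0 < a ∧ z = a) ∧
      (∀ n, 0 < alpha ν X (d n)) ∧
      -- convergence of the coefficients
      (Tendsto (fun n => 1 / alpha ν X (d n) * rateBound π lam m d n) atTop (𝓝 0) →
        ∀ i, 1 ≤ i → ∀ x : H,
          Tendsto (fun n => ‖(theta (lagCov X) ν d n i - ψ i) x‖) atTop (𝓝 0)) ∧
      -- the same along sequences of sample sizes
      (∀ u : ℕ → ℕ, Tendsto u atTop atTop → ∀ i, 1 ≤ i →
        (∀ r < i, Tendsto (fun k => 1 / alpha ν X (d (u k - r)) * rateBound π lam m d (u k - r))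
          atTop (𝓝 0)) →
        ∀ x : H,
          Tendsto (fun k => ‖(theta (lagCov X) ν d (u k) i - ψ i) x‖) atTop (𝓝 0))) := by
  have hinj : ∀ x, crossCov (ε 0) (ε 0) x = 0 → x = 0 := fun x hx =>
    eq_zero_of_apply_eq_zero hεpos hx
  obtain ⟨K, _, hK⟩ := exists_error_bounds (m := m) hε hX hstat hinv hinj heig hlam_pos hd_mono
  refine ⟨⟨⟨?_, ?_⟩, ?_⟩, fun hψ => ?_⟩
  · exact isBigO_of_le (excessError_nonneg _) (rateBound_nonneg hlam_pos)
      (hm_lt.mono fun n hn => (hK n hn).1)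
  · exact isBigO_of_le (excessError_nonneg _) (rateBound_nonneg hlam_pos)
      (hm_lt.mono fun n hn => (hK n hn).2.1)
  · exact tendsto_rateBound (summable_norm_coeff hinv) (hasSum_eigenvalues hstat heig 0).summable
      hm_top hm_div hd_top
  have key : ∀ u : ℕ → ℕ, Tendsto u atTop atTop → ∀ i, 1 ≤ i →
      (∀ r < i, Tendsto (fun k => 1 / alpha ν X (d (u k - r)) * rateBound π lam m d (u k - r))
        atTop (𝓝 0)) →
      ∀ x : H, Tendsto (fun k => ‖(theta (lagCov X) ν d (u k) i - ψ i) x‖) atTop (𝓝 0) := by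
    intro u hu i hi hrate x
    have h := tendsto_thetaExt hε hX hstat hinv hinj heig hlam_pos hψ hd_pos hd_mono hm_top hm_lt
      hd_top i u hu hrate x
    simp only [thetaExt, if_neg (Nat.one_le_iff_ne_zero.1 hi)] at h
    exact tendsto_iff_norm_sub_tendsto_zero.1 h
  refine ⟨fun n ω _ => ?_, fun n => alpha_pos hε hX hinv hinj hψ (hd_pos n), fun hrate i hi => ?_,
    key⟩
  · exact ⟨(hasSum_spectralTerm ν hε hX hψ (d n) ω).summable,
      spectralDensity_isHermitian_and_pos hε hX hinv hinj hψ ω⟩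
  -- the whole sequence is the case `u = id`
  · exact key id tendsto_id i hi fun r _ => hrate.comp (tendsto_sub_atTop_nat r)
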